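/- All systems are finite-dimensional and nonzero, $n\ge 1$, and $\varepsilon$ is a real number (the values of interest are $\varepsilon\in[0,1]$). An $n$-turn strategy $A^n\to B^n$ is a sequence of $n$ quantum channels $A_1\to M_1B_1$, $M_1A_2\to M_2B_2$, …, $M_{n-1}A_n\to B_n$, where the $M_i$ are memory systems; strategies are identified when they have the same Choi operator $\Gamma_{A^nB^n}$, i.e. the same overall channel $A^n\to B^n$. An $n$-turn co-strategy $B^{n-1}\to A^nR$ is a state on $A_1R_1$ followed by channels $R_1B_1\to R_2A_2$, …, $R_{n-1}B_{n-1}\to R_nA_n$, with $R=R_n$ an arbitrary system. Interacting a strategy $\mathcal N$ with a co-strategy $\mathcal S$ gives a state $\mathcal N\circ\mathcal S$ on $RB_n$, given by the link product of the Choi operators. Let $$\|\mathcal N-\mathcal M\|_{\diamond n}=\sup_{\mathcal S}\|\mathcal N\circ\mathcal S-\mathcal M\circ\mathcal S\|_1,$$ and write $\mathcal N\approx_\varepsilon\mathcal M$ if $\tfrac12\|\mathcal N-\mathcal M\|_{\diamond n}\le\varepsilon$; for states, $\rho\approx_\varepsilon\sigma$ means $\tfrac12\|\rho-\sigma\|_1\le\varepsilon$.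 For real $M\ge1$ let $\pi_M=\frac1M|0\rangle\langle0|+(1-\frac1M)|1\rangle\langle1|$. For a strategy box $(\mathcal N,\mathcal M)$, i.e. a pair of $n$-turn strategies $A^n\to B^n$, define the one-shot $\varepsilon$-approximate distillable distinguishability and distinguishability cost $$D_d^\varepsilon(\mathcal N,\mathcal M)=\log_2\sup\{M\ge1:\ \exists\,\mathcal S,\mathcal L:\ \mathcal L(\mathcal N\circ\mathcal S)\approx_\varepsilon|0\rangle\langle0|,\ \mathcal L(\mathcal M\circ\mathcal S)=\pi_M\},$$ $$D_c^\varepsilon(\mathcal N,\mathcal M)=\log_2\inf\{M\ge1:\ \exists\,\mathcal T:\ \mathcal T(|0\rangle\langle0|)\approx_\varepsilon\mathcal N,\ \mathcal T(\pi_M)=\mathcal M\},$$ where $\mathcal S$ ranges over $n$-turn co-strategies, $\mathcal L$ over channels from $RB_n$ to a qubit, and $\mathcal T$ over sequences of channels $XA_1\to M_1B_1$, $M_1A_2\to M_2B_2$, …, $M_{n-1}A_n\to B_n$ with $X$ a qubit, $\mathcal T(\sigma)$ being the strategy obtained by preparing $X$ in the state $\sigma$. Define further $$D_{\min}^\varepsilon(\mathcal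 N\|\mathcal M)=\sup_{\mathcal S}\Big(-\log_2\inf\{\operatorname{Tr}[\Lambda(\mathcal M\circ\mathcal S)]:\ 0\le\Lambda\le I,\ \operatorname{Tr}[\Lambda(\mathcal N\circ\mathcal S)]\ge1-\varepsilon\}\Big),$$ $$D_{\min}(\mathcal N\|\mathcal M)=\sup_{\mathcal S}\big(-\log_2\operatorname{Tr}[\Pi_{\mathcal N\circ\mathcal S}(\mathcal M\circ\mathcal S)]\big),$$ with $\Pi_\rho$ the projection onto the support of $\rho$, and $$D_{\max}(\mathcal N\|\mathcal M)=\inf\{\lambda\in\mathbb R:\ \Gamma^{\mathcal N}\le2^\lambda\,\Gamma^{\mathcal M}\},\qquad D_{\max}^\varepsilon(\mathcal N\|\mathcal M)=\inf_{\widetilde{\mathcal N}\approx_\varepsilon\mathcal N}D_{\max}(\widetilde{\mathcal N}\|\mathcal M),$$ where $\widetilde{\mathcal N}$ ranges over $n$-turn strategies $A^n\to B^n$. All quantities take values in $[-\infty,\infty]$, with $\log_2 0=-\infty$, $\log_2\infty=\infty$, and, in the definitions of $D_d^\varepsilon$, $D_c^\varepsilon$ and the infimum inside $D_{\min}^\varepsilon$,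 which are over subsets of $[0,\infty]$, $\sup\emptyset=0$ and $\inf\emptyset=\infty$. **Theorem.** For every strategy box $(\mathcal N,\mathcal M)$ and every $\varepsilon$, $$D_d^\varepsilon(\mathcal N,\mathcal M)=D_{\min}^\varepsilon(\mathcal N\|\mathcal M),\qquad D_c^\varepsilon(\mathcal N,\mathcal M)=D_{\max}^\varepsilon(\mathcal N\|\mathcal M).$$ In the exact case, $D_d^0(\mathcal N,\mathcal M)=D_{\min}(\mathcal N\|\mathcal M)$ and $D_c^0(\mathcal N,\mathcal M)=D_{\max}(\mathcal N\|\mathcal M)$. -/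

import Mathlib

open scoped ENNReal Matrix Kronecker ComplexOrder

namespace QStrat

noncomputable section

/-! ## Matrices, states, channels -/

/-- Trace norm `‖X‖₁ = Tr √(X† X)`: the sum of the singular values of `X`. -/
def traceNorm {ι : Type} [Fintype ι] [DecidableEq ι] (X : Matrix ι ι ℂ) : ℝ :=
  ∑ i, Real.sqrt ((Matrix.isHermitian_conjTranspose_mul_self X).eigenvalues i)

/-- Löwner order. -/
def LoewnerLE {ι : Type} [Fintype ι] (X Y : Matrix ι ι ℂ) : Prop :=
  (Y - X).PosSemidef

/-- `Φ ⊗ id_κ`, for a linear map `Φ` between matrix algebras. -/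
def ampliate {X Y κ : Type} (Φ : Matrix X X ℂ →ₗ[ℂ] Matrix Y Y ℂ)
    (ρ : Matrix (X × κ) (X × κ) ℂ) : Matrix (Y × κ) (Y × κ) ℂ :=
  Matrix.of fun p q => Φ (Matrix.of fun x x' => ρ (x, p.2) (x', q.2)) p.1 q.1

/-- A quantum channel: a completely positive, trace-preserving linear map. -/
structure Channel (X Y : Type) [Fintype X] [Fintype Y] where
  map : Matrix X X ℂ →ₗ[ℂ] Matrix Y Y ℂ
  completelyPositive : ∀ (k : ℕ) (ρ : Matrix (X × Fin k) (X × Fin k) ℂ),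
    ρ.PosSemidef → (ampliate map ρ).PosSemidef
  tracePreserving : ∀ ρ : Matrix X X ℂ, (map ρ).trace = ρ.trace

/-- Base-two logarithm `[0, ∞] → [-∞, ∞]`. -/
def log2 (x : ℝ≥0∞) : EReal := ENNReal.log x / ((Real.log 2 : ℝ) : EReal)

/-- The orthogonal projection onto the support (= range) of a Hermitian matrix `ρ`. -/
def supportProj {ι : Type} [Fintype ι] [DecidableEq ι] (ρ : Matrix ι ι ℂ) : Matrix ι ι ℂ :=
  Matrix.toEuclideanLin.symm
    ((LinearMap.range (Matrix.toEuclideanLin ρ)).starProjection :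
      EuclideanSpace ℂ ι →ₗ[ℂ] EuclideanSpace ℂ ι)

/-- Min-relative entropy of states: `-log₂ Tr[Π_ρ σ]`. -/
def stateDmin {ι : Type} [Fintype ι] [DecidableEq ι] (ρ σ : Matrix ι ι ℂ) : EReal :=
  -log2 (ENNReal.ofReal (supportProj ρ * σ).trace.re)

/-- Smooth min-relative entropy of states:
`-log₂ inf {Tr[Λ σ] : 0 ≤ Λ ≤ I, Tr[Λ ρ] ≥ 1 - ε}`. -/
def stateDminSmooth {ι : Type} [Fintype ι] [DecidableEq ι] (ε : ℝ) (ρ σ : Matrix ι ι ℂ) :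
    EReal :=
  -log2 (⨅ (Λ : Matrix ι ι ℂ) (_ : LoewnerLE 0 Λ ∧ LoewnerLE Λ 1 ∧ 1 - ε ≤ (Λ * ρ).trace.re),
    ENNReal.ofReal (Λ * σ).trace.re)

/-- Max-relative entropy: `inf {l : X ≤ 2 ^ l Y}`, equal to `∞` if there is no such `l`. -/
def opDmax {ι : Type} [Fintype ι] (X Y : Matrix ι ι ℂ) : EReal :=
  ⨅ (l : ℝ) (_ : LoewnerLE X (((2 : ℝ) ^ l) • Y)), (l : EReal)

/-- The qubit state `|0⟩⟨0|`. -/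
def ket0 : Matrix (Fin 2) (Fin 2) ℂ := Matrix.single 0 0 1

/-- `π_M = (1/M) |0⟩⟨0| + (1 - 1/M) |1⟩⟨1|`, a qubit state for real `M ≥ 1`. -/
def piState (M : ℝ) : Matrix (Fin 2) (Fin 2) ℂ :=
  ((1 / M : ℝ) : ℂ) • Matrix.single 0 0 1 + ((1 - 1 / M : ℝ) : ℂ) • Matrix.single 1 1 1

/-! ## Strategies -/

/-- Index set of a basis of the joint system of the first `n` of the systems of dimensions
`d 0, d 1, …`. -/
abbrev Sys (d : ℕ → ℕ) (n : ℕ) : Type := (i : Fin n) → Fin (d i)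

/-- `Comb dI dO m n r`: `n` channels connected in sequence through memory systems. The memory
before the first channel has dimension `m`, the memory after the last one has dimension `r`, and
channel number `i` takes (memory, input system of dimension `dI i`) to
(memory, output system of dimension `dO i`). -/
inductive Comb (dI dO : ℕ → ℕ) (m : ℕ) : ℕ → ℕ → Type
  | nil : Comb dI dO m 0 m
  | snoc {n s r : ℕ} (c : Comb dI dO m n s)
      (Φ : Channel (Fin s × Fin (dI n)) (Fin r × Fin (dO n))) : Comb dI dO m (n + 1) r

/-- The block `⟨b| 𝒞(σ ⊗ |a⟩⟨a'|) |b'⟩`, an operator on the final memory, where `𝒞` is the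
channel from (initial memory, all inputs) to (all outputs, final memory) that the comb
implements. -/
def Comb.block {dI dO : ℕ → ℕ} {m : ℕ} (σ : Matrix (Fin m) (Fin m) ℂ) :
    {n r : ℕ} → Comb dI dO m n r → Sys dI n → Sys dI n → Sys dO n → Sys dO n →
      Matrix (Fin r) (Fin r) ℂ
  | _, _, .nil, _, _, _, _ => σ
  | n + 1, _, .snoc c Φ, a, a', b, b' =>
      Matrix.of fun k k' =>
        Φ.map
          (Comb.block σ c (fun i => a i.castSucc) (fun i => a' i.castSucc)
              (fun i => b i.castSucc) (fun i => b' i.castSucc) ⊗ₖ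
            Matrix.single (a (Fin.last n)) (a' (Fin.last n)) 1)
          (k, b (Fin.last n)) (k', b' (Fin.last n))

/-- Choi operator, on (inputs, outputs, final memory), of the comb whose initial memory is
prepared in `σ`: its entries are `⟨b, k| 𝒞(σ ⊗ |a⟩⟨a'|) |b', k'⟩`. -/
def Comb.choi {dI dO : ℕ → ℕ} {m n r : ℕ} (c : Comb dI dO m n r)
    (σ : Matrix (Fin m) (Fin m) ℂ) :
    Matrix (Sys dI n × Sys dO n × Fin r) (Sys dI n × Sys dO n × Fin r) ℂ :=
  Matrix.of fun p q => c.block σ p.1 q.1 p.2.1 q.2.1 p.2.2 q.2.2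

/-- An `n`-turn strategy `Aⁿ → Bⁿ`: trivial initial and final memory. -/
abbrev Strategy (dA dB : ℕ → ℕ) (n : ℕ) : Type := Comb dA dB 1 n 1

/-- Operators on `Aⁿ Bⁿ` (and a trivial system). -/
abbrev StrategyOp (dA dB : ℕ → ℕ) (n : ℕ) : Type :=
  Matrix (Sys dA n × Sys dB n × Fin 1) (Sys dA n × Sys dB n × Fin 1) ℂ

/-- Choi operator of a strategy. -/
def Strategy.choi {dA dB : ℕ → ℕ} {n : ℕ} (N : Strategy dA dB n) : StrategyOp dA dB n :=
  Comb.choi N 1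

/-- Input dimensions of a co-strategy: nothing, then `B₁, B₂, …`. -/
def coDim (dB : ℕ → ℕ) : ℕ → ℕ
  | 0 => 1
  | k + 1 => dB k

/-- An `n`-turn co-strategy `Bⁿ⁻¹ → Aⁿ R`, with `R` of dimension `r`: a state on `A₁ R₁`,
followed by channels `R₁ B₁ → R₂ A₂`, `R₂ B₂ → R₃ A₃`, …, the last memory being `R`. -/
abbrev CoStrategy (dA dB : ℕ → ℕ) (n r : ℕ) : Type := Comb (coDim dB) dA 1 n r

/-- The basis index `b` of `Bⁿ` as input index of an `(n + 1)`-turn co-strategy. -/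
def coInput {dB : ℕ → ℕ} {n : ℕ} (b : Sys dB n) : Sys (coDim dB) (n + 1) :=
  Fin.cons (α := fun i : Fin (n + 1) => Fin (coDim dB i)) (0 : Fin 1) b

/-- Output index of an `(n + 1)`-turn strategy from its first `n` entries and the last one. -/
def addLast {dB : ℕ → ℕ} {n : ℕ} (b : Sys dB n) (y : Fin (dB n)) : Sys dB (n + 1) :=
  Fin.snoc (α := fun i : Fin (n + 1) => Fin (dB i)) b y

/-- The link product `Γ * Γ^S` of an operator on `Aⁿ⁺¹ Bⁿ⁺¹` with the Choi operator of an
`(n + 1)`-turn co-strategy `Bⁿ → Aⁿ⁺¹ R`, contracting the systems `Aⁿ⁺¹ Bⁿ` that they share.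
If `Γ` is the Choi operator of a strategy `𝒩`, this is the state `𝒩 ∘ 𝒮` of `R` and the last
system `B`. -/
def interact {dA dB : ℕ → ℕ} {n r : ℕ} (Γ : StrategyOp dA dB (n + 1))
    (S : CoStrategy dA dB (n + 1) r) : Matrix (Fin r × Fin (dB n)) (Fin r × Fin (dB n)) ℂ :=
  Matrix.of fun p q =>
    ∑ a : Sys dA (n + 1), ∑ a' : Sys dA (n + 1), ∑ b : Sys dB n, ∑ b' : Sys dB n,
      Γ (a, addLast b p.2, 0) (a', addLast b' q.2, 0) *
        Comb.choi S 1 (coInput b, a, p.1) (coInput b', a', q.1)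

/-- Strategy distance (for two strategies, given by their Choi operators):
the supremum over all co-strategies of the trace distance of the final states. -/
def strategyDist {dA dB : ℕ → ℕ} {n : ℕ} (Γ Γ' : StrategyOp dA dB (n + 1)) : EReal :=
  ⨆ (r : ℕ) (S : CoStrategy dA dB (n + 1) r),
    ((traceNorm (interact Γ S - interact Γ' S) : ℝ) : EReal)

/-- `Γ ≈_ε Γ'`: the normalized strategy distance is at most `ε`. -/
def StrategyApprox {dA dB : ℕ → ℕ} {n : ℕ} (ε : ℝ) (Γ Γ' : StrategyOp dA dB (n + 1)) : Prop :=
  strategyDist Γ Γ' / 2 ≤ (ε : EReal)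

/-! ## Entropies and operational quantities of strategy boxes

All strategies have `n + 1` turns, that is, at least one. -/

section Box

variable {dA dB : ℕ → ℕ} {n : ℕ}

/-- Strategy min-relative entropy. -/
def Dmin (N M : Strategy dA dB (n + 1)) : EReal :=
  ⨆ (r : ℕ) (S : CoStrategy dA dB (n + 1) r),
    stateDmin (interact N.choi S) (interact M.choi S)

/-- Smooth strategy min-relative entropy. -/
def DminSmooth (ε : ℝ) (N M : Strategy dA dB (n + 1)) : EReal :=
  ⨆ (r : ℕ) (S : CoStrategy dA dB (n + 1) r),
    stateDminSmooth ε (interact N.choi S) (interact M.choi S)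

/-- Strategy max-relative entropy. -/
def Dmax (N M : Strategy dA dB (n + 1)) : EReal := opDmax N.choi M.choi

/-- Smooth strategy max-relative entropy. -/
def DmaxSmooth (ε : ℝ) (N M : Strategy dA dB (n + 1)) : EReal :=
  ⨅ (N' : Strategy dA dB (n + 1)) (_ : StrategyApprox ε N'.choi N.choi), Dmax N' M

/-- One-shot `ε`-approximate distillable distinguishability:
`log₂ sup {M : 𝒩 ∘ 𝒮 ≈_ε |0⟩⟨0|, ℳ ∘ 𝒮 = π_M}` over the co-strategies `𝒮` with qubit output,
that is, a co-strategy `S` with memory `R` and a final channel `L` from `R B` to a qubit. -/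
def distillable (ε : ℝ) (N M : Strategy dA dB (n + 1)) : EReal :=
  log2 (⨆ (r : ℕ) (S : CoStrategy dA dB (n + 1) r)
      (L : Channel (Fin r × Fin (dB n)) (Fin 2)) (K : ℝ)
      (_ : 1 ≤ K ∧ traceNorm (L.map (interact N.choi S) - ket0) / 2 ≤ ε ∧
        L.map (interact M.choi S) = piState K),
    ENNReal.ofReal K)

/-- One-shot `ε`-approximate distinguishability cost:
`log₂ inf {M : 𝒮(|0⟩⟨0|) ≈_ε 𝒩, 𝒮(π_M) = ℳ}` over the sequences `𝒮` of channels
`X A₁ → M₁ B₁`, `M₁ A₂ → M₂ B₂`, … with `X` a qubit. -/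
def cost (ε : ℝ) (N M : Strategy dA dB (n + 1)) : EReal :=
  log2 (⨅ (S : Comb dA dB 2 (n + 1) 1) (K : ℝ)
      (_ : 1 ≤ K ∧ StrategyApprox ε (S.choi ket0) N.choi ∧ S.choi (piState K) = M.choi),
    ENNReal.ofReal K)

end Box

end

end QStrat

open QStrat

/-! Distillation. Fix a co-strategy and let ρ, σ be the final states of the two strategies. A
channel `L` to a qubit matters only through its effect Λ with Tr[Λτ] = ⟨0|L(τ)|0⟩: the condition
L(σ) = π_K forces Tr[Λσ] = 1/K, and closeness of L(ρ) to |0⟩⟨0| forces Tr[Λρ] ≥ 1 - ε. Conversely,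
measuring Λ gives such a channel, with K = 1/Tr[Λσ]; when Tr[Λσ] = 0, mixing Λ with the identity
reaches every K. Thus the two quantities agree for each co-strategy (`log2_le_stateDminSmooth`,
`stateDminSmooth_le_log2`). At ε = 0 the least feasible test is the support projection
(`stateDminSmooth_zero`).

Cost. If T(|0⟩⟨0|) = N' and T(π_K) = M, linearity gives M = (1/K) N' + (1 - 1/K) T(|1⟩⟨1|), hence N'
≤ K M for the Choi operators. Conversely, if N' ≤ K M, the remainder (K M - N')/(K - 1) is positive
and correctly normalized, so a comb controlled by the qubit can run N' on |0⟩ and the remainder on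
|1⟩ (`exists_complement`, `exists_comb_controlled`). This rests on the realization theorem
`exists_comb_of_isCausal`: positivity and the recursive normalization `IsCausal` suffice for an
operator to come from a sequence of channels. It is proved by building a purification channel by
channel, each new channel being an isometry relating two factorizations of one positive matrix.

At ε = 0 it remains to see that strategies at distance zero have equal Choi operators; a single
informationally complete co-strategy shows this (`exists_informationally_complete`). -/

namespace QStrat

/-! ### Positive semidefinite matrices -/

section PosSemidef

variable {ι κ : Type}

theorem posSemidef_of_eq {A B : Matrix ι ι ℂ} (hB : B.PosSemidef) (h : A = B) : A.PosSemidef :=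
  h ▸ hB

/-- This is the compression of `Q` by the unnormalized vector ∑ u, |u⟩ on the first factor, the form
in which a link product contracts shared systems. -/
theorem posSemidef_sum_sum [Fintype ι] [Fintype κ] {Q : Matrix (κ × ι) (κ × ι) ℂ}
    (hQ : Q.PosSemidef) : (Matrix.of fun p q => ∑ u, ∑ u', Q (u, p) (u', q)).PosSemidef := by
  classical
  refine posSemidef_of_eq (hQ.conjTranspose_mul_mul_same
    (Matrix.of fun (p : κ × ι) q => if p.2 = q then (1 : ℂ) else 0)) ?_
  ext p q
  simp only [Matrix.of_apply, Matrix.mul_apply, Matrix.conjTranspose_apply, Fintype.sum_prod_type,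
    apply_ite star, star_one, star_zero, ite_mul, one_mul, zero_mul, mul_ite, mul_one, mul_zero,
    Finset.sum_ite_eq', Finset.mem_univ, if_true]
  exact Finset.sum_comm

theorem posSemidef_partialTrace [Fintype κ] {Q : Matrix (κ × ι) (κ × ι) ℂ}
    (hQ : Q.PosSemidef) : (Matrix.of fun p q => ∑ u, Q (u, p) (u, q)).PosSemidef := by
  refine posSemidef_of_eq (Matrix.posSemidef_sum Finset.univ
    fun u _ => hQ.submatrix fun p : ι => (u, p)) ?_
  ext p q
  simp [Matrix.sum_apply]

theorem posSemidef_single [DecidableEq ι] (i : ι) : (Matrix.single i i (1 : ℂ)).PosSemidef := by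
  rw [← Matrix.diagonal_single]
  refine Matrix.PosSemidef.diagonal fun j => ?_
  by_cases h : j = i <;> simp [h]

open scoped MatrixOrder Matrix.Norms.L2Operator in
theorem exists_eq_conjTranspose_mul [Fintype ι] [DecidableEq ι] {A : Matrix ι ι ℂ}
    (hA : A.PosSemidef) : ∃ C : Matrix ι ι ℂ, A = Cᴴ * C :=
  CStarAlgebra.nonneg_iff_eq_star_mul_self.mp hA.nonneg

end PosSemidef

/-! ### Multi-indices with a last entry split off -/

section Sys

variable {d : ℕ → ℕ} {n : ℕ}

@[simp] theorem addLast_castSucc (a : Sys d n) (x : Fin (d n)) (i : Fin n) :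
    addLast a x i.castSucc = a i := by
  simp [addLast]

@[simp] theorem addLast_last (a : Sys d n) (x : Fin (d n)) :
    addLast a x (Fin.last n) = x := by
  simp [addLast]

theorem addLast_init (a : Sys d (n + 1)) :
    addLast (dB := d) (fun i : Fin n => a i.castSucc) (a (Fin.last n)) = a :=
  Fin.snoc_init_self a

theorem addLast_inj {a a' : Sys d n} {x x' : Fin (d n)} :
    addLast a x = addLast a' x' ↔ a = a' ∧ x = x' := by
  constructor
  · intro h
    refine ⟨funext fun i => ?_, ?_⟩
    · simpa using congrFun h i.castSucc
    · simpa using congrFun h (Fin.last n)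
  · rintro ⟨rfl, rfl⟩
    rfl

theorem sum_addLast {M : Type*} [AddCommMonoid M] (f : Sys d (n + 1) → M) :
    ∑ a, f a = ∑ a : Sys d n, ∑ x : Fin (d n), f (addLast a x) := by
  rw [← Equiv.sum_comp (Fin.snocEquiv fun i : Fin (n + 1) => Fin (d i)), Fintype.sum_prod_type,
    Finset.sum_comm]
  rfl

theorem coInput_addLast (b : Sys d n) (y : Fin (d n)) :
    coInput (addLast b y) = addLast (dB := coDim d) (coInput b) y := by
  funext i
  refine Fin.lastCases ?_ (fun i => ?_) i
  · exact (addLast_last b y).trans (addLast_last (d := coDim d) (coInput b) y).symm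
  · refine Eq.trans ?_ (addLast_castSucc (d := coDim d) (coInput b) y i).symm
    refine Fin.cases ?_ (fun j => ?_) i
    · rfl
    · exact addLast_castSucc b y j

end Sys

/-! ### Positivity and normalization of Choi operators of combs -/

section Channel

variable {X Y κ : Type} [Fintype X] [Fintype Y] [Fintype κ]

theorem Channel.posSemidef_ampliate (Φ : Channel X Y) {ρ : Matrix (X × κ) (X × κ) ℂ}
    (hρ : ρ.PosSemidef) : (ampliate Φ.map ρ).PosSemidef := by
  let e := Fintype.equivFin κ
  have h := Φ.completelyPositive _ _
    (hρ.submatrix (fun p : X × Fin (Fintype.card κ) => (p.1, e.symm p.2)))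
  convert h.submatrix (fun p : Y × κ => (p.1, e p.2)) using 1
  ext p q
  simp [ampliate]

end Channel

/-- The Choi operator of the family `P` of initial states processed by a comb is positive. -/
theorem Comb.posSemidef_block {dI dO : ℕ → ℕ} {m n r : ℕ} (c : Comb dI dO m n r)
    {κ : Type} [Fintype κ] {P : κ → κ → Matrix (Fin m) (Fin m) ℂ}
    (hP : (Matrix.of fun p q : κ × Fin m => P p.1 q.1 p.2 q.2).PosSemidef) :
    (Matrix.of fun p q : (κ × Sys dI n × Sys dO n) × Fin r =>
      c.block (P p.1.1 q.1.1) p.1.2.1 q.1.2.1 p.1.2.2 q.1.2.2 p.2 q.2).PosSemidef := by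
  induction c with
  | nil => exact hP.submatrix fun p : (κ × Sys dI 0 × Sys dO 0) × Fin m => (p.1.1, p.2)
  | @snoc n s r c Φ ih =>
    -- The new factor is the unnormalized maximally entangled state of the next input and a copy of
    -- it; Φ acts on one half and the copy becomes the input index of the block.
    have h1 := ih.kronecker
      (Matrix.posSemidef_vecMulVec_self_star (fun p : Fin (dI n) × Fin (dI n) =>
        if p.1 = p.2 then (1 : ℂ) else 0))
    have h2 := h1.submatrix (fun p : (Fin s × Fin (dI n)) × (κ × Sys dI (n + 1) × Sys dO (n + 1)) =>
      (((p.2.1, (fun i => p.2.2.1 i.castSucc), (fun i => p.2.2.2 i.castSucc)), p.1.1),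
        (p.1.2, p.2.2.1 (Fin.last n))))
    have h3 := (Φ.posSemidef_ampliate h2).submatrix
      (fun p : (κ × Sys dI (n + 1) × Sys dO (n + 1)) × Fin r =>
        ((p.2, p.1.2.2 (Fin.last n)), p.1))
    refine posSemidef_of_eq h3 ?_
    ext p q
    simp only [Matrix.of_apply, Matrix.submatrix_apply, ampliate, Comb.block]
    refine congrFun (congrFun (congrArg (⇑Φ.map) ?_) _) _
    ext x x'
    simp only [Matrix.kroneckerMap_apply, Matrix.of_apply, Matrix.vecMulVec_apply,
      Matrix.single_apply, Pi.star_apply]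
    congr 1
    simp only [eq_comm (a := x.2), eq_comm (a := x'.2)]
    split_ifs <;> simp_all

theorem Comb.posSemidef_choi {dI dO : ℕ → ℕ} {m n r : ℕ} (c : Comb dI dO m n r)
    {σ : Matrix (Fin m) (Fin m) ℂ} (hσ : σ.PosSemidef) : (c.choi σ).PosSemidef :=
  (c.posSemidef_block (κ := Unit) (P := fun _ _ => σ)
    (hσ.submatrix fun p : Unit × Fin m => p.2)).submatrix
      fun p : Sys dI n × Sys dO n × Fin r => ((((), p.1, p.2.1) : Unit × Sys dI n × Sys dO n), p.2.2)

theorem Comb.block_snoc {dI dO : ℕ → ℕ} {m n s r : ℕ} (c : Comb dI dO m n s)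
    (Φ : Channel (Fin s × Fin (dI n)) (Fin r × Fin (dO n))) (σ : Matrix (Fin m) (Fin m) ℂ)
    (a a' : Sys dI n) (x x' : Fin (dI n)) (b b' : Sys dO n) (y y' : Fin (dO n)) (k k' : Fin r) :
    (c.snoc Φ).block σ (addLast a x) (addLast a' x') (addLast b y) (addLast b' y') k k' =
      Φ.map (c.block σ a a' b b' ⊗ₖ Matrix.single x x' 1) (k, y) (k', y') := by
  simp [Comb.block]

/-- Trace preservation of the last channel removes it, and the trace of |x⟩⟨x'| leaves the delta. -/
theorem Comb.sum_trace_block_snoc {dI dO : ℕ → ℕ} {m n s r : ℕ} (c : Comb dI dO m n s)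
    (Φ : Channel (Fin s × Fin (dI n)) (Fin r × Fin (dO n))) (σ : Matrix (Fin m) (Fin m) ℂ)
    (a a' : Sys dI n) (x x' : Fin (dI n)) (b b' : Sys dO n) :
    ∑ y, ((c.snoc Φ).block σ (addLast a x) (addLast a' x') (addLast b y) (addLast b' y)).trace =
      if x = x' then (c.block σ a a' b b').trace else 0 := by
  have h := Φ.tracePreserving (c.block σ a a' b b' ⊗ₖ Matrix.single x x' 1)
  rw [Matrix.trace_kronecker] at h
  simp only [Matrix.trace, Matrix.diag, Comb.block_snoc] at h ⊢
  rw [Finset.sum_comm, ← Fintype.sum_prod_type', h]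
  simp [Matrix.single_apply, ite_and, eq_comm]

/-- The normalization conditions of a Choi operator `T` on (initial memory, inputs, outputs):
tracing out the last output leaves the identity on the last input, times an operator on the
other systems that satisfies the same conditions. -/
def IsCausal {κ : Type} [DecidableEq κ] {dI dO : ℕ → ℕ} : (n : ℕ) →
    Matrix (κ × Sys dI n × Sys dO n) (κ × Sys dI n × Sys dO n) ℂ → Prop
  | 0, T => T = 1
  | n + 1, T => ∃ T' : Matrix (κ × Sys dI n × Sys dO n) (κ × Sys dI n × Sys dO n) ℂ,
      IsCausal n T' ∧ ∀ i i' a a' x x' b b',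
        ∑ y, T (i, addLast a x, addLast b y) (i', addLast a' x', addLast b' y) =
          if x = x' then T' (i, a, b) (i', a', b') else 0

theorem Comb.isCausal_trace_block {dI dO : ℕ → ℕ} {m n r : ℕ} (c : Comb dI dO m n r)
    {σ : Matrix (Fin m) (Fin m) ℂ} (hσ : σ.trace = 1) :
    IsCausal n (Matrix.of fun p q : Unit × Sys dI n × Sys dO n =>
      (c.block σ p.2.1 q.2.1 p.2.2 q.2.2).trace) := by
  induction c with
  | nil =>
    ext p q
    obtain rfl : p = q := Subsingleton.elim _ _
    simpa [Comb.block] using hσ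
  | snoc c Φ ih =>
    refine ⟨_, ih, fun i i' a a' x x' b b' => ?_⟩
    exact c.sum_trace_block_snoc Φ σ a a' x x' b b'

/-! ### The link product is a state -/

section Interact

variable {dA dB : ℕ → ℕ} {n r : ℕ}

theorem posSemidef_interact {Γ : StrategyOp dA dB (n + 1)} (hΓ : Γ.PosSemidef)
    (S : CoStrategy dA dB (n + 1) r) : (interact Γ S).PosSemidef := by
  have h := (hΓ.kronecker (S.posSemidef_choi Matrix.PosSemidef.one)).submatrix
    (fun p : (Sys dA (n + 1) × Sys dB n) × (Fin r × Fin (dB n)) =>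
      ((p.1.1, addLast p.1.2 p.2.2, (0 : Fin 1)), (coInput p.1.2, p.1.1, p.2.1)))
  refine posSemidef_of_eq (posSemidef_sum_sum h) ?_
  ext p q
  simp only [interact, Matrix.of_apply, Matrix.submatrix_apply, Matrix.kroneckerMap_apply,
    Fintype.sum_prod_type]
  exact Finset.sum_congr rfl fun a _ => Finset.sum_comm

theorem sum_trace_block_snoc_mul {m s : ℕ} (N : Comb dA dB m n s)
    (Φ : Channel (Fin s × Fin (dA n)) (Fin r × Fin (dB n))) (σ : Matrix (Fin m) (Fin m) ℂ)
    (b b' : Sys dB n) (F : Sys dA (n + 1) → Sys dA (n + 1) → ℂ) :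
    ∑ a, ∑ a', (∑ y, ((N.snoc Φ).block σ a a' (addLast b y) (addLast b' y)).trace) * F a a' =
      ∑ a, ∑ a', (N.block σ a a' b b').trace * ∑ x, F (addLast a x) (addLast a' x) := by
  simp only [sum_addLast (d := dA), Comb.sum_trace_block_snoc, ite_mul, zero_mul,
    Finset.sum_ite_eq, Finset.mem_univ, if_true, Finset.mul_sum]
  exact Finset.sum_congr rfl fun a _ => Finset.sum_comm

/-- Normalization of the final state, by peeling channels off alternately: discarding the last
strategy output identifies the two copies of its last input, so the last co-strategy output is
discarded in turn, and so on down to the initial state. -/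
theorem sum_trace_block_mul_trace_block : ∀ {n s r : ℕ} (N : Comb dA dB 1 (n + 1) s)
    (S : CoStrategy dA dB (n + 1) r),
    ∑ b : Sys dB n, ∑ b' : Sys dB n, ∑ a, ∑ a',
      (∑ y, (N.block 1 a a' (addLast b y) (addLast b' y)).trace) *
        (S.block 1 (coInput b) (coInput b') a a').trace = 1
  | 0, _, _, .snoc .nil Φ, .snoc .nil Ψ => by
    -- The first co-strategy channel has the one-dimensional input `coDim dB 0 = 1`, so it prepares
    -- a state of trace one.
    have hS (a a' : Sys dA 0) := Comb.sum_trace_block_snoc (dO := dA) .nil Ψ 1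
      (default : Sys (coDim dB) 0) default (0 : Fin 1) (0 : Fin 1) a a'
    simp only [sum_trace_block_snoc_mul, Fintype.sum_unique]
    refine (congrArg _ ((hS _ _).trans (if_pos rfl))).trans ?_
    simp [Comb.block]
  | n + 1, _, _, .snoc N Φ, .snoc S Ψ => by
    rw [← sum_trace_block_mul_trace_block N S]
    have hS (b b' : Sys dB n) (y y' : Fin (dB n)) (a a' : Sys dA (n + 1)) :
        ∑ x, ((S.snoc Ψ).block 1 (coInput (addLast b y)) (coInput (addLast b' y'))
          (addLast a x) (addLast a' x)).trace =
        if y = y' then (S.block 1 (coInput b) (coInput b') a a').trace else 0 := by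
      rw [coInput_addLast, coInput_addLast]
      exact S.sum_trace_block_snoc Ψ 1 (coInput b) (coInput b') y y' a a'
    simp only [sum_trace_block_snoc_mul]
    rw [sum_addLast (d := dB)]
    refine Finset.sum_congr rfl fun b _ => ?_
    simp only [sum_addLast (d := dB), hS]
    rw [Finset.sum_comm]
    refine Finset.sum_congr rfl fun b' _ => ?_
    simp only [mul_ite, mul_zero, Finset.sum_mul]
    simp only [Finset.sum_ite_irrel, Finset.sum_const_zero, Finset.sum_ite_eq,
      Finset.mem_univ, if_true]
    rw [Finset.sum_comm]
    exact Finset.sum_congr rfl fun a _ => Finset.sum_comm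

theorem sum_rearrange {α β γ δ : Type} [Fintype α] [Fintype β] [Fintype γ] [Fintype δ]
    (f : α → β → γ → γ → δ → δ → ℂ) :
    ∑ k, ∑ y, ∑ a, ∑ a', ∑ b, ∑ b', f k y a a' b b' =
      ∑ b, ∑ b', ∑ a, ∑ a', ∑ y, ∑ k, f k y a a' b b' := by
  have h := Fintype.sum_equiv
    (⟨fun p => (p.2.2.2.2.1, p.2.2.2.2.2, p.2.2.1, p.2.2.2.1, p.2.1, p.1),
      fun q => (q.2.2.2.2.2, q.2.2.2.2.1, q.2.2.1, q.2.2.2.1, q.1, q.2.1),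
      fun _ => rfl, fun _ => rfl⟩ : α × β × γ × γ × δ × δ ≃ δ × δ × γ × γ × β × α)
    (fun p => f p.1 p.2.1 p.2.2.1 p.2.2.2.1 p.2.2.2.2.1 p.2.2.2.2.2)
    (fun q => f q.2.2.2.2.2 q.2.2.2.2.1 q.2.2.1 q.2.2.2.1 q.1 q.2.1) (fun _ => rfl)
  simpa only [Fintype.sum_prod_type] using h

theorem trace_interact (N : Strategy dA dB (n + 1)) (S : CoStrategy dA dB (n + 1) r) :
    (interact N.choi S).trace = 1 := by
  rw [← sum_trace_block_mul_trace_block N S]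
  simp only [Matrix.trace, Matrix.diag, interact, Matrix.of_apply, Fintype.sum_prod_type,
    Strategy.choi, Comb.choi, Finset.univ_unique, Finset.sum_singleton, Finset.sum_mul_sum]
  exact sum_rearrange _

theorem Strategy.posSemidef_choi {n : ℕ} (N : Strategy dA dB n) : N.choi.PosSemidef :=
  Comb.posSemidef_choi N Matrix.PosSemidef.one

end Interact

/-! ### Uniqueness of factorizations up to isometry -/

section IsometryExtension

/-- Two factorizations `A Aᴴ = B Bᴴ` differ by an isometry. -/
theorem exists_mul_eq_of_mul_conjTranspose_eq {p q q' : Type} [Fintype p] [Fintype q] [Fintype q']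
    [DecidableEq p] [DecidableEq q] [DecidableEq q'] (hq : Fintype.card q ≤ Fintype.card q')
    (A : Matrix p q ℂ) (B : Matrix p q' ℂ) (h : A * Aᴴ = B * Bᴴ) :
    ∃ V : Matrix q q' ℂ, V * Vᴴ = 1 ∧ A * V = B := by
  obtain ⟨f⟩ := Function.Embedding.nonempty_of_card_le hq
  -- `E` pads `A` with zero columns to the width of `B`, so that a partial isometry between the two
  -- can be extended inside a single space.
  let E : Matrix q q' ℂ := Matrix.of fun i j => if f i = j then 1 else 0
  have hE : E * Eᴴ = 1 := by
    ext i j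
    simp [E, Matrix.mul_apply, Matrix.one_apply, apply_ite (starRingEnd ℂ), eq_comm]
  let LA := Matrix.toEuclideanLin (A * E)ᴴ
  let LB := Matrix.toEuclideanLin Bᴴ
  have hAE : (A * E) * (A * E)ᴴ = B * Bᴴ := by
    rw [Matrix.conjTranspose_mul, Matrix.mul_assoc, ← Matrix.mul_assoc E, hE, Matrix.one_mul, h]
  have hnorm (v : EuclideanSpace ℂ p) : ‖LA v‖ = ‖LB v‖ := by
    have key (C : Matrix p q' ℂ) : ((‖Matrix.toEuclideanLin Cᴴ v‖ ^ 2 : ℝ) : ℂ) =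
        inner ℂ v (Matrix.toEuclideanLin (C * Cᴴ) v) := by
      rw [Matrix.toLpLin_mul_same, LinearMap.comp_apply, Matrix.toEuclideanLin_conjTranspose_eq_adjoint,
        ← LinearMap.adjoint_inner_left, inner_self_eq_norm_sq_to_K]
      simp
    have : ((‖LA v‖ ^ 2 : ℝ) : ℂ) = ((‖LB v‖ ^ 2 : ℝ) : ℂ) := by
      rw [key, key, hAE]
    have h2 : ‖LA v‖ ^ 2 = ‖LB v‖ ^ 2 := by exact_mod_cast this
    exact (sq_eq_sq₀ (norm_nonneg _) (norm_nonneg _)).1 h2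
  have hker : LinearMap.ker LA ≤ LinearMap.ker LB := fun v hv => by
    rw [LinearMap.mem_ker] at hv ⊢
    rw [← norm_eq_zero, ← hnorm, hv, norm_zero]
  -- Equality of norms makes `LA v ↦ LB v` well defined and isometric on the range of `LA`.
  obtain ⟨g, hg⟩ : ∃ g : LinearMap.range LA →ₗ[ℂ] EuclideanSpace ℂ q',
      ∀ v, g ⟨LA v, v, rfl⟩ = LB v := by
    refine ⟨(LinearMap.ker LA).liftQ LB hker ∘ₗ LA.quotKerEquivRange.symm.toLinearMap, fun v => ?_⟩
    have : LA.quotKerEquivRange.symm ⟨LA v, v, rfl⟩ = (LinearMap.ker LA).mkQ v := by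
      rw [LinearEquiv.symm_apply_eq]
      rfl
    simp [this]
  let L : LinearMap.range LA →ₗᵢ[ℂ] EuclideanSpace ℂ q' :=
    ⟨g, by
      rintro ⟨_, v, rfl⟩
      rw [hg, ← hnorm]
      rfl⟩
  have hL (v : EuclideanSpace ℂ p) : L.extend (LA v) = LB v :=
    (LinearIsometry.extend_apply L ⟨LA v, v, rfl⟩).trans (hg v)
  let U : Matrix q' q' ℂ := Matrix.toEuclideanLin.symm L.extend.toLinearMap
  have hU : Uᴴ * U = 1 := by
    apply Matrix.toEuclideanLin.injective
    rw [Matrix.toLpLin_mul_same, Matrix.toEuclideanLin_conjTranspose_eq_adjoint,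
      LinearEquiv.apply_symm_apply, Matrix.toLpLin_one]
    refine LinearMap.ext fun v => ext_inner_left ℂ fun w => ?_
    rw [LinearMap.comp_apply, LinearMap.adjoint_inner_right]
    exact L.extend.inner_map_map w v
  have hUA : U * (A * E)ᴴ = Bᴴ := by
    apply Matrix.toEuclideanLin.injective
    refine LinearMap.ext fun v => ?_
    rw [Matrix.toLpLin_mul_same, LinearMap.comp_apply, LinearEquiv.apply_symm_apply]
    exact hL v
  refine ⟨E * Uᴴ, ?_, ?_⟩
  · rw [Matrix.conjTranspose_mul, Matrix.conjTranspose_conjTranspose, Matrix.mul_assoc,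
      ← Matrix.mul_assoc Uᴴ, hU, Matrix.one_mul, hE]
  · rw [← Matrix.mul_assoc, ← Matrix.conjTranspose_conjTranspose (A * E),
      ← Matrix.conjTranspose_mul, hUA, Matrix.conjTranspose_conjTranspose]

end IsometryExtension

/-! ### Isometric channels and discarding of memory -/

section Channels

variable {X Y : Type} [Fintype X] [Fintype Y]

/-- The channel `ρ ↦ Vᵀ ρ (Vᵀ)ᴴ`. -/
def Channel.ofIsometry [DecidableEq X] (V : Matrix X Y ℂ) (hV : V * Vᴴ = 1) : Channel X Y where
  map :=
    { toFun := fun ρ => Vᵀ * ρ * Vᵀᴴ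
      map_add' := fun ρ σ => by rw [Matrix.mul_add, Matrix.add_mul]
      map_smul' := fun z ρ => by simp }
  completelyPositive k ρ hρ := by
    refine posSemidef_of_eq (hρ.mul_mul_conjTranspose_same (Vᵀ ⊗ₖ (1 : Matrix (Fin k) (Fin k) ℂ))) ?_
    ext p q
    simp [ampliate, Matrix.mul_apply, Fintype.sum_prod_type, Matrix.one_apply,
      apply_ite (starRingEnd ℂ)]
  tracePreserving ρ := by
    -- The rows of `V` are orthonormal, so it is `Vᵀ` that is an isometry.
    have h : Vᵀᴴ * Vᵀ = 1 := by
      rw [← Matrix.transpose_one, ← hV, Matrix.transpose_mul]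
      rfl
    change (Vᵀ * ρ * Vᵀᴴ).trace = _
    rw [Matrix.trace_mul_comm, ← Matrix.mul_assoc, h, Matrix.one_mul]

theorem Channel.ofIsometry_map [DecidableEq X] (V : Matrix X Y ℂ) (hV : V * Vᴴ = 1)
    (ρ : Matrix X X ℂ) : (Channel.ofIsometry V hV).map ρ = Vᵀ * ρ * Vᵀᴴ := rfl

theorem Channel.ofIsometry_map_kronecker_single {K Z : Type} [Fintype K] [Fintype Z]
    [DecidableEq K] [DecidableEq Z] (V : Matrix (K × Z) Y ℂ) (hV : V * Vᴴ = 1) (M : Matrix K K ℂ)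
    (z z' : Z) (y y' : Y) :
    (Channel.ofIsometry V hV).map (M ⊗ₖ Matrix.single z z' 1) y y' =
      ∑ j', ∑ j, V (j, z) y * M j j' * star (V (j', z') y') := by
  simp [Channel.ofIsometry_map, Matrix.mul_apply, Fintype.sum_prod_type, Matrix.single_apply,
    ite_and, Finset.sum_mul]

/-- The channel followed by the trace over its output memory. -/
def Channel.discard {r : ℕ} (Φ : Channel X (Fin r × Y)) : Channel X (Fin 1 × Y) where
  map :=
    { toFun := fun ρ => Matrix.of fun p q => ∑ k, Φ.map ρ (k, p.2) (k, q.2)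
      map_add' := fun ρ σ => by
        ext
        simp [Finset.sum_add_distrib]
      map_smul' := fun z ρ => by
        ext
        simp [Finset.mul_sum] }
  completelyPositive k ρ hρ := by
    exact posSemidef_partialTrace ((Φ.completelyPositive k ρ hρ).submatrix
      fun p : Fin r × ((Fin 1 × Y) × Fin k) => ((p.1, p.2.1.2), p.2.2))
  tracePreserving ρ := by
    rw [← Φ.tracePreserving ρ]
    simp only [Matrix.trace, Matrix.diag, Fintype.sum_prod_type, LinearMap.coe_mk, AddHom.coe_mk,
      Matrix.of_apply, Fintype.sum_unique]
    exact Finset.sum_comm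

end Channels


/-! ### Realization of causal operators by combs -/

section Realization

variable {dI dO : ℕ → ℕ} {m n : ℕ}

/-- `T'` is a diagonal block of a partial trace of `T`, obtained by fixing the last input to one
basis state; this is where a nonzero input dimension enters. -/
theorem IsCausal.posSemidef_of_succ {κ : Type} [DecidableEq κ]
    {T : Matrix (κ × Sys dI (n + 1) × Sys dO (n + 1)) (κ × Sys dI (n + 1) × Sys dO (n + 1)) ℂ}
    (hT : T.PosSemidef) (hI : 0 < dI n)
    {T' : Matrix (κ × Sys dI n × Sys dO n) (κ × Sys dI n × Sys dO n) ℂ}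
    (h : ∀ i i' a a' x x' b b',
      ∑ y, T (i, addLast a x, addLast b y) (i', addLast a' x', addLast b' y) =
        if x = x' then T' (i, a, b) (i', a', b') else 0) : T'.PosSemidef := by
  refine posSemidef_of_eq (posSemidef_partialTrace (hT.submatrix
    fun p : Fin (dO n) × (κ × Sys dI n × Sys dO n) =>
      (p.2.1, addLast p.2.2.1 ⟨0, hI⟩, addLast p.2.2.2 p.1))) ?_
  ext p q
  exact ((h p.1 q.1 p.2.1 q.2.1 ⟨0, hI⟩ ⟨0, hI⟩ p.2.2 q.2.2).trans (if_pos rfl)).symm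

/-- A positive matrix factors through any space of sufficiently large dimension. -/
theorem exists_mul_conjTranspose_eq {ι : Type} [Fintype ι] [DecidableEq ι] {T : Matrix ι ι ℂ}
    (hT : T.PosSemidef) (d : ℕ) : ∃ (r : ℕ) (G : Matrix ι (Fin r) ℂ), d ≤ r ∧ G * Gᴴ = T := by
  obtain ⟨B, hB⟩ := exists_eq_conjTranspose_mul hT
  let e := (Fintype.equivFin (ι ⊕ Fin d)).symm
  refine ⟨_, (Matrix.fromCols Bᴴ (0 : Matrix ι (Fin d) ℂ)).submatrix id e, ?_, ?_⟩
  · simp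
  · rw [Matrix.conjTranspose_submatrix, Matrix.submatrix_mul_equiv, hB,
      Matrix.conjTranspose_fromCols_eq_fromRows_conjTranspose, Matrix.fromCols_mul_fromRows]
    simp

/-- Every positive operator satisfying the normalization conditions has a purification that is
implemented by a comb. -/
theorem exists_comb_purification : ∀ {n : ℕ}, (∀ i < n, 0 < dI i) → (∀ i < n, 0 < dO i) →
    ∀ {T : Matrix (Fin m × Sys dI n × Sys dO n) (Fin m × Sys dI n × Sys dO n) ℂ},
    IsCausal n T → T.PosSemidef →
    ∃ (r : ℕ) (c : Comb dI dO m n r) (G : Matrix (Fin m × Sys dI n × Sys dO n) (Fin r) ℂ),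
      G * Gᴴ = T ∧ ∀ (σ : Matrix (Fin m) (Fin m) ℂ) a a' b b',
        c.block σ a a' b b' =
          ∑ i, ∑ i', σ i i' • Matrix.vecMulVec (G (i, a, b)) (star (G (i', a', b')))
  | 0, _, _, T, hT, _ => by
    refine ⟨m, .nil, Matrix.of fun p k => if p.1 = k then 1 else 0, ?_, fun σ a a' b b' => ?_⟩
    · rw [show T = 1 from hT]
      ext p q
      obtain ⟨i, a⟩ := p
      obtain ⟨j, b⟩ := q
      obtain rfl : a = b := Subsingleton.elim _ _
      simp [Matrix.mul_apply, Matrix.one_apply, eq_comm]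
    · ext k k'
      simp [Comb.block, Matrix.sum_apply, Matrix.vecMulVec_apply]
  | n + 1, hI, hO, T, hT, hp => by
    obtain ⟨T', hT', h⟩ := hT
    obtain ⟨r, c, G, hG, hc⟩ := exists_comb_purification (fun i hi => hI i (by omega))
      (fun i hi => hO i (by omega)) hT' (IsCausal.posSemidef_of_succ hp (hI n (by omega)) h)
    -- The new memory is taken large enough for an isometry from the old memory and the new input
    -- into the new memory and the new output.
    obtain ⟨r', G', hr', hG'⟩ := exists_mul_conjTranspose_eq hp (r * dI n)
    have hcard : Fintype.card (Fin r × Fin (dI n)) ≤ Fintype.card (Fin r' × Fin (dO n)) := by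
      simpa using hr'.trans (Nat.le_mul_of_pos_right _ (hO n (by omega)))
    let B : Matrix ((Fin m × Sys dI n × Sys dO n) × Fin (dI n)) (Fin r' × Fin (dO n)) ℂ :=
      Matrix.of fun p q => G' (p.1.1, addLast p.1.2.1 p.2, addLast p.1.2.2 q.2) q.1
    -- The normalization condition says that G ⊗ 1 and `B`, which is `G'` with the last output moved
    -- to the columns, both factor T' ⊗ 1. The isometry relating them is the next channel.
    obtain ⟨V, hV, hGV⟩ := exists_mul_eq_of_mul_conjTranspose_eq hcard
      (G ⊗ₖ (1 : Matrix (Fin (dI n)) (Fin (dI n)) ℂ)) B (by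
        rw [Matrix.conjTranspose_kronecker, ← Matrix.mul_kronecker_mul, hG,
          Matrix.conjTranspose_one, Matrix.one_mul]
        ext ⟨⟨i, a, b⟩, x⟩ ⟨⟨i', a', b'⟩, x'⟩
        have h1 := h i i' a a' x x' b b'
        rw [← hG'] at h1
        simp only [Matrix.mul_apply, Matrix.conjTranspose_apply] at h1
        simp only [Matrix.kroneckerMap_apply, Matrix.one_apply, mul_ite, mul_one, mul_zero, ← h1,
          Matrix.mul_apply, Matrix.conjTranspose_apply, Fintype.sum_prod_type, B, Matrix.of_apply]
        exact Finset.sum_comm)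
    refine ⟨r', c.snoc (Channel.ofIsometry V hV), G', hG', fun σ a a' b b' => ?_⟩
    rw [← addLast_init a, ← addLast_init a', ← addLast_init b, ← addLast_init b']
    ext k k'
    have hB (i : Fin m) (a : Sys dI n) (b : Sys dO n) x y k :
        ∑ j, G (i, a, b) j * V (j, x) (k, y) = G' (i, addLast a x, addLast b y) k := by
      simpa [Matrix.mul_apply, Fintype.sum_prod_type, Matrix.one_apply, B] using
        congrFun (congrFun hGV ((i, a, b), x)) (k, y)
    rw [Comb.block_snoc, hc, Channel.ofIsometry_map_kronecker_single]
    simp only [Matrix.sum_apply, Matrix.smul_apply, Matrix.vecMulVec_apply, Pi.star_apply,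
      ← hB, star_sum, star_mul', smul_eq_mul, Finset.mul_sum, Finset.sum_mul]
    rw [Finset.sum_comm]
    simp only [Finset.sum_comm (s := (Finset.univ : Finset (Fin r)))
      (t := (Finset.univ : Finset (Fin m)))]
    refine Finset.sum_congr rfl fun i _ => Finset.sum_congr rfl fun i' _ => ?_
    rw [Finset.sum_comm]
    refine Finset.sum_congr rfl fun j' _ => Finset.sum_congr rfl fun j _ => ?_
    ring

/-- Every positive operator satisfying the normalization conditions is the Choi operator of a comb
with trivial final memory. -/
theorem exists_comb_of_isCausal (hI : ∀ i < n + 1, 0 < dI i) (hO : ∀ i < n + 1, 0 < dO i)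
    {T : Matrix (Fin m × Sys dI (n + 1) × Sys dO (n + 1))
      (Fin m × Sys dI (n + 1) × Sys dO (n + 1)) ℂ} (hT : IsCausal (n + 1) T) (hp : T.PosSemidef) :
    ∃ c : Comb dI dO m (n + 1) 1, ∀ (σ : Matrix (Fin m) (Fin m) ℂ) a a' b b' k k',
      c.block σ a a' b b' k k' = ∑ i, ∑ i', σ i i' * T (i, a, b) (i', a', b') := by
  obtain ⟨r, c, G, hG, hc⟩ := exists_comb_purification hI hO hT hp
  cases c with
  | snoc c Φ =>
    -- Tracing out the purifying memory turns G Gᴴ back into `T`; the trace is absorbed into the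
    -- last channel.
    refine ⟨c.snoc Φ.discard, fun σ a a' b b' k k' => ?_⟩
    have h : (c.snoc Φ.discard).block σ a a' b b' k k' =
      ∑ l, (c.snoc Φ).block σ a a' b b' l l := rfl
    simp only [h, hc, Matrix.sum_apply, ← hG, Matrix.mul_apply, Matrix.smul_apply,
      Matrix.vecMulVec_apply, Matrix.conjTranspose_apply, Pi.star_apply, smul_eq_mul,
      Finset.mul_sum]
    rw [Finset.sum_comm]
    exact Finset.sum_congr rfl fun i _ => Finset.sum_comm

end Realization

/-! ### The extended base-two logarithm -/

section Log2

theorem coe_log_two_pos : (0 : EReal) < ((Real.log 2 : ℝ) : EReal) :=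
  EReal.coe_pos.2 (Real.log_pos one_lt_two)

/-- With `le_log2_iff`, this moves the logarithm across an inequality, so that a supremum or infimum
inside it can be bounded term by term. -/
theorem log2_le_iff {x : ℝ≥0∞} {y : EReal} :
    log2 x ≤ y ↔ x ≤ EReal.exp ((Real.log 2 : ℝ) * y) := by
  rw [log2, EReal.div_le_iff_le_mul coe_log_two_pos (EReal.coe_ne_top _)]
  exact (ENNReal.logOrderIso.le_symm_apply).symm

theorem le_log2_iff {x : ℝ≥0∞} {y : EReal} :
    y ≤ log2 x ↔ EReal.exp (y * (Real.log 2 : ℝ)) ≤ x := by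
  rw [log2, EReal.le_div_iff_mul_le coe_log_two_pos (EReal.coe_ne_top _)]
  exact (ENNReal.logOrderIso.symm_apply_le).symm

theorem log2_mono {x y : ℝ≥0∞} (h : x ≤ y) : log2 x ≤ log2 y :=
  EReal.div_le_div_right_of_nonneg coe_log_two_pos.le (ENNReal.log_monotone h)

theorem log2_inv (x : ℝ≥0∞) : log2 x⁻¹ = -log2 x := by
  rw [log2, log2, ENNReal.log_inv, EReal.div_eq_inv_mul, EReal.div_eq_inv_mul, mul_neg]

theorem log2_ofReal {x : ℝ} (hx : 0 < x) : log2 (ENNReal.ofReal x) = (Real.logb 2 x : ℝ) := by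
  rw [log2, ENNReal.log_ofReal_of_pos hx, ← EReal.coe_div]
  rfl

end Log2

/-! ### Traces of products of positive matrices -/

section Trace

variable {ι : Type} [Fintype ι] [DecidableEq ι] {A B : Matrix ι ι ℂ}

theorem trace_mul_nonneg (hA : A.PosSemidef) (hB : B.PosSemidef) : 0 ≤ (A * B).trace := by
  obtain ⟨C, rfl⟩ := exists_eq_conjTranspose_mul hA
  rw [Matrix.mul_assoc, Matrix.trace_mul_comm]
  exact (hB.mul_mul_conjTranspose_same C).trace_nonneg

theorem trace_mul_eq_re (hA : A.PosSemidef) (hB : B.PosSemidef) :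
    (A * B).trace = ((A * B).trace.re : ℂ) :=
  (Complex.eq_re_of_ofReal_le (r := 0) (by simpa using trace_mul_nonneg hA hB))

theorem trace_mul_re_nonneg (hA : A.PosSemidef) (hB : B.PosSemidef) : 0 ≤ (A * B).trace.re :=
  (Complex.le_def.1 (trace_mul_nonneg hA hB)).1

/-- With A = CᴴC and B = DᴴD, the trace is the squared Hilbert–Schmidt norm of C Dᴴ. -/
theorem mul_eq_zero_of_trace_mul_eq_zero (hA : A.PosSemidef) (hB : B.PosSemidef)
    (h : (A * B).trace = 0) : A * B = 0 := by
  obtain ⟨C, rfl⟩ := exists_eq_conjTranspose_mul hA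
  obtain ⟨D, rfl⟩ := exists_eq_conjTranspose_mul hB
  have h' : (C * Dᴴ) * (C * Dᴴ)ᴴ = C * (Dᴴ * D) * Cᴴ := by
    simp only [Matrix.conjTranspose_mul, Matrix.conjTranspose_conjTranspose, Matrix.mul_assoc]
  rw [Matrix.mul_assoc, Matrix.trace_mul_comm, ← h',
    Matrix.trace_mul_conjTranspose_self_eq_zero_iff] at h
  rw [Matrix.mul_assoc, ← Matrix.mul_assoc C, h, Matrix.zero_mul, Matrix.mul_zero]

end Trace

/-! ### Trace norm -/

section TraceNorm

theorem traceNorm_eq_of_conjTranspose_mul_self {ι : Type} [Fintype ι] [DecidableEq ι]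
    {X : Matrix ι ι ℂ} {c : ℝ} (h : Xᴴ * X = algebraMap ℝ _ c) :
    traceNorm X = Fintype.card ι * Real.sqrt c := by
  have key (i : ι) : (Matrix.isHermitian_conjTranspose_mul_self X).eigenvalues i = c := by
    have : Nonempty ι := ⟨i⟩
    have h1 := (Matrix.isHermitian_conjTranspose_mul_self X).eigenvalues_mem_spectrum_real i
    have h2 : spectrum ℝ (Xᴴ * X) = {c} := by rw [h, spectrum.scalar_eq]
    rwa [h2, Set.mem_singleton_iff] at h1
  simp [traceNorm, key]

/-- The difference is a traceless Hermitian 2 × 2 matrix, so its square is a scalar and its two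
singular values coincide. -/
theorem traceNorm_qubit_sub_ket0 {τ : Matrix (Fin 2) (Fin 2) ℂ} (hτ : τ.IsHermitian)
    (htr : τ.trace = 1) :
    traceNorm (τ - ket0) / 2 = Real.sqrt ((1 - (τ 0 0).re) ^ 2 + Complex.normSq (τ 0 1)) := by
  have h00 : τ 0 0 = ((τ 0 0).re : ℂ) := (Complex.conj_eq_iff_re.1 (hτ.apply 0 0)).symm
  have h11 : τ 1 1 = 1 - τ 0 0 := by
    rw [← htr, Matrix.trace_fin_two]
    ring
  have hc : (starRingEnd ℂ) (τ 0 0) = τ 0 0 := hτ.apply 0 0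
  have h10 : τ 1 0 = (starRingEnd ℂ) (τ 0 1) := (hτ.apply 1 0).symm
  have h : (τ - ket0)ᴴ * (τ - ket0) =
      algebraMap ℝ _ ((1 - (τ 0 0).re) ^ 2 + Complex.normSq (τ 0 1)) := by
    ext i j
    fin_cases i <;> fin_cases j <;>
    simp [Matrix.mul_apply, ket0, Matrix.algebraMap_matrix_apply, h10, h11, hc, ← h00,
        Complex.normSq_eq_conj_mul_self]
    all_goals ring
  rw [traceNorm_eq_of_conjTranspose_mul_self h]
  simp

theorem eq_zero_of_traceNorm_eq_zero {ι : Type} [Fintype ι] [DecidableEq ι]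
    {X : Matrix ι ι ℂ} (h : traceNorm X = 0) : X = 0 := by
  have hp := Matrix.posSemidef_conjTranspose_mul_self X
  rw [traceNorm, Finset.sum_eq_zero_iff_of_nonneg fun i _ => Real.sqrt_nonneg _] at h
  have h0 : (Matrix.isHermitian_conjTranspose_mul_self X).eigenvalues = 0 := funext fun i =>
    (Real.sqrt_eq_zero (hp.eigenvalues_nonneg i)).1 (h i (Finset.mem_univ i))
  rw [Matrix.IsHermitian.eigenvalues_eq_zero_iff] at h0
  exact Matrix.conjTranspose_mul_self_eq_zero.1 h0

theorem traceNorm_nonneg {ι : Type} [Fintype ι] [DecidableEq ι] (X : Matrix ι ι ℂ) :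
    0 ≤ traceNorm X :=
  Finset.sum_nonneg fun _ _ => Real.sqrt_nonneg _

end TraceNorm

/-! ### Effects and two-outcome measurements -/

section Effects

variable {X Y : Type} [Fintype X] [Fintype Y] [DecidableEq X]

omit [DecidableEq X] in
theorem Channel.posSemidef_map (Φ : Channel X Y) {ρ : Matrix X X ℂ} (hρ : ρ.PosSemidef) :
    (Φ.map ρ).PosSemidef :=
  (Φ.posSemidef_ampliate (hρ.submatrix fun p : X × Unit => p.1)).submatrix
    fun y : Y => (y, ())

/-- The effect `Λ` with `Tr[Λ ρ] = ⟨y| Φ(ρ) |y⟩`. -/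
noncomputable def Channel.effect (Φ : Channel X Y) (y : Y) : Matrix X X ℂ :=
  Matrix.of fun x x' => Φ.map (Matrix.single x' x 1) y y

/-- Up to transposition, the effect is a diagonal block of the Choi operator of Φ. -/
theorem Channel.posSemidef_effect (Φ : Channel X Y) (y : Y) : (Φ.effect y).PosSemidef := by
  refine Matrix.PosSemidef.transpose (M := (Φ.effect y)ᵀ) ?_
  refine posSemidef_of_eq ((Φ.posSemidef_ampliate (Matrix.posSemidef_vecMulVec_self_star
    (fun p : X × X => if p.1 = p.2 then (1 : ℂ) else 0))).submatrix fun x : X => (y, x)) ?_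
  ext x x'
  simp only [Channel.effect, Matrix.transpose_apply, Matrix.of_apply, Matrix.submatrix_apply,
    ampliate]
  refine congrFun (congrFun (congrArg (⇑Φ.map) ?_) _) _
  ext z z'
  simp only [Matrix.single_apply, Matrix.of_apply, Matrix.vecMulVec_apply, Pi.star_apply,
    eq_comm (a := z), eq_comm (a := z')]
  split_ifs <;> simp_all

theorem Channel.trace_effect_mul (Φ : Channel X Y) (y : Y) (ρ : Matrix X X ℂ) :
    (Φ.effect y * ρ).trace = Φ.map ρ y y := by
  conv_rhs => rw [Matrix.matrix_eq_sum_single ρ]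
  simp only [map_sum, Matrix.sum_apply, Matrix.trace, Matrix.diag, Matrix.mul_apply,
    Channel.effect, Matrix.of_apply]
  rw [Finset.sum_comm]
  refine Finset.sum_congr rfl fun x _ => Finset.sum_congr rfl fun x' _ => ?_
  rw [show Matrix.single x x' (ρ x x') = ρ x x' • Matrix.single x x' 1 by simp, map_smul]
  simp [mul_comm]

theorem Channel.sum_effect (Φ : Channel X Y) : ∑ y, Φ.effect y = 1 := by
  ext x x'
  have h := Φ.tracePreserving (Matrix.single x' x 1)
  simp only [Matrix.trace, Matrix.diag] at h
  simp only [Matrix.sum_apply, Channel.effect, Matrix.of_apply, h]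
  simp [Matrix.single_apply, Matrix.one_apply, ite_and]

/-- The measurement of a two-outcome observable. -/
noncomputable def Channel.measure (Λ : Matrix X X ℂ) (h0 : Λ.PosSemidef)
    (h1 : (1 - Λ).PosSemidef) : Channel X (Fin 2) where
  map :=
    { toFun := fun ρ => (Λ * ρ).trace • Matrix.single 0 0 1 +
        ((1 - Λ) * ρ).trace • Matrix.single 1 1 1
      map_add' := fun ρ σ => by
        simp only [Matrix.mul_add, Matrix.trace_add, add_smul]
        abel
      map_smul' := fun z ρ => by
        simp only [Matrix.mul_smul, Matrix.trace_smul, smul_eq_mul, mul_smul, smul_add,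
          RingHom.id_apply] }
  completelyPositive k ρ hρ := by
    have key {A : Matrix X X ℂ} (hA : A.PosSemidef) : (Matrix.of fun j j' : Fin k =>
        (A * Matrix.of fun x x' => ρ (x, j) (x', j')).trace).PosSemidef := by
      obtain ⟨C, rfl⟩ := exists_eq_conjTranspose_mul hA
      refine posSemidef_of_eq (posSemidef_partialTrace
        (hρ.mul_mul_conjTranspose_same (C ⊗ₖ (1 : Matrix (Fin k) (Fin k) ℂ)))) ?_
      ext j j'
      rw [Matrix.of_apply, Matrix.mul_assoc, Matrix.trace_mul_comm]
      simp [Matrix.trace, Matrix.mul_apply, Fintype.sum_prod_type, Matrix.one_apply,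
        apply_ite (starRingEnd ℂ)]
    refine posSemidef_of_eq (((posSemidef_single (0 : Fin 2)).kronecker (key h0)).add
      ((posSemidef_single (1 : Fin 2)).kronecker (key h1))) ?_
    ext p q
    simp only [ampliate, LinearMap.coe_mk, AddHom.coe_mk, Matrix.of_apply, Matrix.add_apply,
      Matrix.smul_apply, smul_eq_mul, Matrix.kroneckerMap_apply]
    ring
  tracePreserving ρ := by
    simp [Matrix.trace_add, Matrix.sub_mul]

theorem Channel.measure_map (Λ : Matrix X X ℂ) (h0 : Λ.PosSemidef) (h1 : (1 - Λ).PosSemidef)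
    (ρ : Matrix X X ℂ) : (Channel.measure Λ h0 h1).map ρ =
      (Λ * ρ).trace • Matrix.single 0 0 1 + ((1 - Λ) * ρ).trace • Matrix.single 1 1 1 := rfl

end Effects

/-! ### Support projection and exact min-relative entropy -/

section SupportProj

variable {ι : Type} [Fintype ι] [DecidableEq ι] (ρ : Matrix ι ι ℂ)

theorem toEuclideanLin_supportProj : Matrix.toEuclideanLin (supportProj ρ) =
    ((LinearMap.range (Matrix.toEuclideanLin ρ)).starProjection :
      EuclideanSpace ℂ ι →ₗ[ℂ] EuclideanSpace ℂ ι) :=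
  LinearEquiv.apply_symm_apply _ _

theorem supportProj_conjTranspose : (supportProj ρ)ᴴ = supportProj ρ := by
  rw [← Matrix.IsHermitian, ← Matrix.isSymmetric_toEuclideanLin_iff, toEuclideanLin_supportProj]
  exact Submodule.starProjection_isSymmetric _

theorem mul_supportProj_eq_zero {C : Matrix ι ι ℂ} (h : C * ρ = 0) : C * supportProj ρ = 0 := by
  apply Matrix.toEuclideanLin.injective
  refine LinearMap.ext fun v => ?_
  rw [Matrix.toLpLin_mul_same, LinearMap.comp_apply, toEuclideanLin_supportProj]
  obtain ⟨w, hw⟩ := Submodule.starProjection_apply_mem (LinearMap.range (Matrix.toEuclideanLin ρ)) v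
  have h' := congrArg (fun f => f w) (congrArg Matrix.toEuclideanLin h)
  simp only [Matrix.toLpLin_mul_same, LinearMap.comp_apply] at h'
  rw [ContinuousLinearMap.coe_coe, ← hw]
  simpa using h'

theorem supportProj_mul_self : supportProj ρ * ρ = ρ := by
  apply Matrix.toEuclideanLin.injective
  refine LinearMap.ext fun v => ?_
  rw [Matrix.toLpLin_mul_same, LinearMap.comp_apply, toEuclideanLin_supportProj]
  exact Submodule.starProjection_eq_self_iff.2 ⟨v, rfl⟩

theorem supportProj_mul_supportProj : supportProj ρ * supportProj ρ = supportProj ρ := by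
  have h := mul_supportProj_eq_zero ρ (C := supportProj ρ - 1)
    (by rw [Matrix.sub_mul, supportProj_mul_self, Matrix.one_mul, sub_self])
  rwa [Matrix.sub_mul, Matrix.one_mul, sub_eq_zero] at h

theorem posSemidef_supportProj : (supportProj ρ).PosSemidef := by
  rw [← supportProj_mul_supportProj]
  nth_rw 1 [← supportProj_conjTranspose]
  exact Matrix.posSemidef_conjTranspose_mul_self _

theorem posSemidef_one_sub_supportProj : (1 - supportProj ρ).PosSemidef := by
  refine posSemidef_of_eq (Matrix.posSemidef_conjTranspose_mul_self (1 - supportProj ρ)) ?_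
  rw [Matrix.conjTranspose_sub, Matrix.conjTranspose_one, supportProj_conjTranspose,
    Matrix.sub_mul, Matrix.mul_sub (supportProj ρ), supportProj_mul_supportProj]
  simp

/-- A test that accepts ρ with certainty satisfies (1 - Λ)ρ = 0, hence ΛΠ = Π = ΠΛ for the support
projection Π. Then Λ - Π = (1 - Π)Λ(1 - Π) ≥ 0, so Π is the least such test. -/
theorem stateDminSmooth_zero {ρ σ : Matrix ι ι ℂ} (hρ : ρ.PosSemidef) (hρ1 : ρ.trace = 1)
    (hσ : σ.PosSemidef) : stateDminSmooth 0 ρ σ = stateDmin ρ σ := by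
  rw [stateDminSmooth, stateDmin]
  refine congrArg (fun x => -log2 x) (le_antisymm ?_ ?_)
  · refine iInf₂_le (supportProj ρ) ⟨?_, posSemidef_one_sub_supportProj ρ, ?_⟩
    · rw [LoewnerLE, sub_zero]
      exact posSemidef_supportProj ρ
    · rw [supportProj_mul_self, hρ1]
      simp
  · refine le_iInf₂ fun Λ hΛ => ENNReal.ofReal_le_ofReal ?_
    obtain ⟨h0, h1, h⟩ := hΛ
    rw [LoewnerLE, sub_zero] at h0
    have hre := trace_mul_re_nonneg h1 hρ
    have htr : ((1 - Λ) * ρ).trace = 0 := by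
      rw [trace_mul_eq_re h1 hρ]
      rw [Matrix.sub_mul, Matrix.trace_sub, Matrix.one_mul, hρ1] at hre ⊢
      simp only [Complex.sub_re, Complex.one_re] at hre ⊢
      norm_cast
      linarith
    have hP := mul_supportProj_eq_zero ρ (mul_eq_zero_of_trace_mul_eq_zero h1 hρ htr)
    rw [Matrix.sub_mul, Matrix.one_mul, sub_eq_zero] at hP
    have hP' : supportProj ρ * Λ = supportProj ρ := by
      rw [← supportProj_conjTranspose, ← h0.isHermitian, ← Matrix.conjTranspose_mul, ← hP]
    have hD : (Λ - supportProj ρ).PosSemidef := by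
      refine posSemidef_of_eq (h0.conjTranspose_mul_mul_same (1 - supportProj ρ)) ?_
      rw [Matrix.conjTranspose_sub, Matrix.conjTranspose_one, supportProj_conjTranspose,
        Matrix.sub_mul 1, Matrix.one_mul, hP', Matrix.mul_sub, Matrix.mul_one, Matrix.sub_mul, ← hP,
        supportProj_mul_supportProj, sub_self, sub_zero]
    have := trace_mul_re_nonneg hD hσ
    rw [Matrix.sub_mul, Matrix.trace_sub, Complex.sub_re] at this
    linarith

end SupportProj

/-! ### Distillable distinguishability -/

section Distillable

variable {dA dB : ℕ → ℕ} {n : ℕ}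

theorem DminSmooth_zero (N M : Strategy dA dB (n + 1)) : DminSmooth 0 N M = Dmin N M := by
  refine iSup_congr fun r => iSup_congr fun S => ?_
  exact stateDminSmooth_zero (posSemidef_interact N.posSemidef_choi S) (trace_interact N S)
    (posSemidef_interact M.posSemidef_choi S)

variable {ι : Type} [Fintype ι] [DecidableEq ι] {ε : ℝ} {ρ σ : Matrix ι ι ℂ}

theorem log2_le_stateDminSmooth (hρ : ρ.PosSemidef) (hρ1 : ρ.trace = 1) (L : Channel ι (Fin 2))
    {K : ℝ} (hK : 1 ≤ K) (h : traceNorm (L.map ρ - ket0) / 2 ≤ ε) (hσ : L.map σ = piState K) :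
    log2 (ENNReal.ofReal K) ≤ stateDminSmooth ε ρ σ := by
  rw [stateDminSmooth, ← log2_inv]
  refine log2_mono ?_
  rw [ENNReal.le_inv_iff_le_inv, ← ENNReal.ofReal_inv_of_pos (by linarith)]
  refine (iInf₂_le (L.effect 0) ⟨?_, ?_, ?_⟩).trans (le_of_eq ?_)
  · rw [L.trace_effect_mul, hσ]
    simp [piState]
  · rw [LoewnerLE, sub_zero]
    exact L.posSemidef_effect 0
  · rw [LoewnerLE, ← L.sum_effect, Fin.sum_univ_two, add_sub_cancel_left]
    exact L.posSemidef_effect 1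
  · rw [L.trace_effect_mul]
    rw [traceNorm_qubit_sub_ket0 (L.posSemidef_map hρ).isHermitian
      ((L.tracePreserving ρ).trans hρ1)] at h
    -- An off-diagonal entry of the output can only increase its distance to |0⟩⟨0|.
    have h2 : 1 - (L.map ρ 0 0).re ≤ Real.sqrt ((1 - (L.map ρ 0 0).re) ^ 2 +
        Complex.normSq (L.map ρ 0 1)) :=
      Real.le_sqrt_of_sq_le (by linarith [Complex.normSq_nonneg (L.map ρ 0 1)])
    linarith

theorem exists_channel_of_effect (hρ : ρ.PosSemidef) (hρ1 : ρ.trace = 1) (hσ : σ.PosSemidef)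
    (hσ1 : σ.trace = 1) {Λ : Matrix ι ι ℂ} (h0 : Λ.PosSemidef) (h1 : (1 - Λ).PosSemidef)
    (h : 1 - ε ≤ (Λ * ρ).trace.re) (hs : 0 < (Λ * σ).trace.re) :
    ∃ L : Channel ι (Fin 2), 1 ≤ ((Λ * σ).trace.re)⁻¹ ∧ traceNorm (L.map ρ - ket0) / 2 ≤ ε ∧
      L.map σ = piState ((Λ * σ).trace.re)⁻¹ := by
  refine ⟨Channel.measure Λ h0 h1, ?_, ?_, ?_⟩
  · rw [one_le_inv₀ hs]
    have := trace_mul_re_nonneg h1 hσ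
    rw [Matrix.sub_mul, Matrix.trace_sub, Matrix.one_mul, hσ1, Complex.sub_re,
      Complex.one_re] at this
    linarith
  · have hle := trace_mul_re_nonneg h1 hρ
    rw [Matrix.sub_mul, Matrix.trace_sub, Matrix.one_mul, hρ1, Complex.sub_re,
      Complex.one_re] at hle
    rw [traceNorm_qubit_sub_ket0 ((Channel.measure Λ h0 h1).posSemidef_map hρ).isHermitian
      ((Channel.tracePreserving _ ρ).trans hρ1)]
    -- The measured output is diagonal, so the distance is exactly 1 - Tr[Λρ].
    simp only [Channel.measure_map, Matrix.add_apply, Matrix.smul_apply]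
    simp [Real.sqrt_sq hle]
    linarith
  · rw [Channel.measure_map, piState, Matrix.sub_mul, Matrix.trace_sub, Matrix.one_mul, hσ1]
    congr 2
    · rw [trace_mul_eq_re h0 hσ]
      simp
    · rw [trace_mul_eq_re h0 hσ]
      simp

theorem stateDminSmooth_le_log2 (hρ : ρ.PosSemidef) (hρ1 : ρ.trace = 1) (hσ : σ.PosSemidef)
    (hσ1 : σ.trace = 1) {D : ℝ≥0∞} (hD : ∀ (L : Channel ι (Fin 2)) (K : ℝ), 1 ≤ K →
      traceNorm (L.map ρ - ket0) / 2 ≤ ε → L.map σ = piState K → ENNReal.ofReal K ≤ D) :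
    stateDminSmooth ε ρ σ ≤ log2 D := by
  rw [stateDminSmooth, ← log2_inv]
  refine log2_mono ?_
  rw [ENNReal.inv_le_iff_inv_le]
  refine le_iInf₂ fun Λ hΛ => ?_
  obtain ⟨h0, h1, h⟩ := hΛ
  rw [LoewnerLE, sub_zero] at h0
  rw [ENNReal.inv_le_iff_inv_le]
  rcases (trace_mul_re_nonneg h0 hσ).eq_or_lt with hs | hs
  · have hle := trace_mul_re_nonneg h1 hρ
    rw [Matrix.sub_mul, Matrix.trace_sub, Matrix.one_mul, hρ1, Complex.sub_re,
      Complex.one_re] at hle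
    suffices hD' : D = ⊤ by simp [hD']
    refine ENNReal.eq_top_of_forall_nnreal_le fun q => ?_
    set K : ℝ := max 1 q with hK
    have hK1 : 1 ≤ K := le_max_left _ _
    have hKi : K⁻¹ ≤ 1 := inv_le_one_of_one_le₀ hK1
    have hKp : 0 < K⁻¹ := by positivity
    -- Since Tr[Λσ] = 0, this mixture has Tr[Λ'σ] = 1/K exactly, while Tr[Λ'ρ] ≥ Tr[Λρ]. As K is
    -- arbitrarily large, `D` is infinite.
    let Λ' : Matrix ι ι ℂ := (1 - K⁻¹) • Λ + K⁻¹ • (1 : Matrix ι ι ℂ)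
    have hΛ'0 : Λ'.PosSemidef :=
      (h0.smul (sub_nonneg.2 hKi)).add (Matrix.PosSemidef.one.smul hKp.le)
    have hΛ'1 : (1 - Λ').PosSemidef := by
      refine posSemidef_of_eq (Matrix.PosSemidef.smul h1 (sub_nonneg.2 hKi)) ?_
      simp only [Λ']
      module
    have htr (τ : Matrix ι ι ℂ) (hτ : τ.trace = 1) :
        (Λ' * τ).trace.re = (1 - K⁻¹) * (Λ * τ).trace.re + K⁻¹ := by
      simp only [Λ', Matrix.add_mul, Matrix.smul_mul, Matrix.trace_add, Matrix.trace_smul,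
        Matrix.one_mul, hτ, Complex.add_re, Complex.real_smul, Complex.re_ofReal_mul,
        Complex.ofReal_re, mul_one]
    have hΛ'σ : (Λ' * σ).trace.re = K⁻¹ := by rw [htr σ hσ1, ← hs, mul_zero, zero_add]
    obtain ⟨L, hL1, hL2, hL3⟩ := exists_channel_of_effect (ε := ε) hρ hρ1 hσ hσ1 hΛ'0 hΛ'1
      (by rw [htr ρ hρ1]; nlinarith) (by rwa [hΛ'σ])
    rw [hΛ'σ, inv_inv] at hL1 hL3
    refine le_trans ?_ (hD L K hL1 hL2 hL3)
    rw [← ENNReal.ofReal_coe_nnreal]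
    exact ENNReal.ofReal_le_ofReal (le_max_right _ _)
  · obtain ⟨L, hL1, hL2, hL3⟩ := exists_channel_of_effect hρ hρ1 hσ hσ1 h0 h1 h hs
    rw [← ENNReal.ofReal_inv_of_pos hs]
    exact hD L _ hL1 hL2 hL3

theorem distillable_eq_DminSmooth (ε : ℝ) (N M : Strategy dA dB (n + 1)) :
    distillable ε N M = DminSmooth ε N M := by
  refine le_antisymm ?_ ?_
  · rw [distillable, log2_le_iff]
    refine iSup_le fun r => iSup_le fun S => iSup_le fun L => iSup_le fun K => iSup_le fun h => ?_
    rw [← log2_le_iff]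
    exact (log2_le_stateDminSmooth (posSemidef_interact N.posSemidef_choi S) (trace_interact N S)
      L h.1 h.2.1 h.2.2).trans (le_iSup₂_of_le r S le_rfl)
  · refine iSup₂_le fun r S => stateDminSmooth_le_log2
      (posSemidef_interact N.posSemidef_choi S) (trace_interact N S)
      (posSemidef_interact M.posSemidef_choi S) (trace_interact M S) fun L K hK h1 h2 => ?_
    exact le_iSup_of_le r <| le_iSup_of_le S <| le_iSup_of_le L <| le_iSup_of_le K <|
      le_iSup_of_le ⟨hK, h1, h2⟩ le_rfl

end Distillable

/-! ### Constructions preserving the normalization conditions -/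

section Causal

variable {κ : Type} [DecidableEq κ] {dI dO : ℕ → ℕ} {n : ℕ}

theorem IsCausal.trace_eq [Fintype κ] :
    ∀ {n : ℕ} {T : Matrix (κ × Sys dI n × Sys dO n) (κ × Sys dI n × Sys dO n) ℂ},
    IsCausal n T → T.trace = Fintype.card κ * ∏ i ∈ Finset.range n, (dI i : ℂ)
  | 0, T, hT => by
    rw [show T = 1 from hT]
    simp [Matrix.trace_one]
  | n + 1, T, ⟨T', hT', h⟩ => by
    rw [Finset.prod_range_succ, ← mul_assoc, ← hT'.trace_eq]
    simp only [Matrix.trace, Matrix.diag, Fintype.sum_prod_type, sum_addLast, h, if_true,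
      Finset.sum_mul]
    refine Finset.sum_congr rfl fun i _ => Finset.sum_congr rfl fun a _ => ?_
    rw [Finset.sum_comm]
    simp only [Finset.sum_const, Finset.card_univ, Fintype.card_fin, nsmul_eq_mul,
      mul_comm]

/-- Coefficients are not required to be nonnegative: the remainder in `exists_complement` is an
affine combination with a negative weight. -/
theorem IsCausal.affine {x y : ℂ} (hxy : x + y = 1) :
    ∀ {n : ℕ} {T U : Matrix (κ × Sys dI n × Sys dO n) (κ × Sys dI n × Sys dO n) ℂ},
    IsCausal n T → IsCausal n U → IsCausal n (x • T + y • U)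
  | 0, T, U, hT, hU => by
    rw [show T = 1 from hT, show U = 1 from hU, ← add_smul, hxy, one_smul]
    rfl
  | n + 1, T, U, ⟨T', hT', hT⟩, ⟨U', hU', hU⟩ => by
    refine ⟨_, hT'.affine hxy hU', fun i i' a a' z z' b b' => ?_⟩
    simp only [Matrix.add_apply, Matrix.smul_apply, smul_eq_mul, Finset.sum_add_distrib,
      ← Finset.mul_sum, hT, hU]
    split_ifs <;> simp

theorem isCausal_smul_one : ∀ {n : ℕ}, (∀ i < n, 0 < dO i) →
    IsCausal n ((∏ i ∈ Finset.range n, (dO i : ℂ)⁻¹) •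
      (1 : Matrix (κ × Sys dI n × Sys dO n) (κ × Sys dI n × Sys dO n) ℂ))
  | 0, _ => by simp [IsCausal]
  | n + 1, h => by
    refine ⟨_, isCausal_smul_one fun i hi => h i (by omega), fun i i' a a' x x' b b' => ?_⟩
    have h0 : (dO n : ℂ) ≠ 0 := by exact_mod_cast (h n (by omega)).ne'
    simp only [Matrix.smul_apply, Matrix.one_apply, Prod.mk.injEq, addLast_inj, smul_eq_mul,
      Finset.prod_range_succ, and_true]
    by_cases hx : x = x'
    · by_cases hh : i = i' ∧ a = a' ∧ b = b'
      · obtain ⟨rfl, rfl, rfl⟩ := hh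
        simp [hx]
        field_simp
      · have : ¬ (i = i' ∧ (a = a' ∧ x = x') ∧ b = b') := fun h => hh ⟨h.1, h.2.1.1, h.2.2⟩
        simp [this, hh]
    · simp [hx]

/-- The operator that applies `T i` when the initial system is in the basis state `i`. -/
def controlled (T : κ → Matrix (Unit × Sys dI n × Sys dO n) (Unit × Sys dI n × Sys dO n) ℂ) :
    Matrix (κ × Sys dI n × Sys dO n) (κ × Sys dI n × Sys dO n) ℂ :=
  Matrix.of fun p q => if p.1 = q.1 then T p.1 ((), p.2) ((), q.2) else 0

theorem isCausal_controlled : ∀ {n : ℕ}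
    {T : κ → Matrix (Unit × Sys dI n × Sys dO n) (Unit × Sys dI n × Sys dO n) ℂ},
    (∀ i, IsCausal n (T i)) → IsCausal n (controlled T)
  | 0, T, h => by
    ext p q
    have hT (i : κ) : T i = 1 := h i
    simp [controlled, hT, Matrix.one_apply, Prod.ext_iff, eq_iff_true_of_subsingleton]
  | n + 1, T, h => by
    choose T' hT' hT using h
    refine ⟨controlled T', isCausal_controlled hT', fun i i' a a' x x' b b' => ?_⟩
    by_cases hi : i = i' <;> simp [controlled, hi, hT]

theorem posSemidef_controlled [Fintype κ]
    {T : κ → Matrix (Unit × Sys dI n × Sys dO n) (Unit × Sys dI n × Sys dO n) ℂ}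
    (h : ∀ i, (T i).PosSemidef) : (controlled T).PosSemidef := by
  refine posSemidef_of_eq (Matrix.posSemidef_sum Finset.univ fun i _ =>
    ((posSemidef_single i).kronecker (h i)).submatrix
      fun p : κ × Sys dI n × Sys dO n => (p.1, ((), p.2))) ?_
  ext p q
  simp only [controlled, Matrix.of_apply, Matrix.sum_apply, Matrix.submatrix_apply,
    Matrix.kroneckerMap_apply, Matrix.single_apply, ite_and, ite_mul, one_mul, zero_mul,
    Finset.sum_ite_eq', Finset.mem_univ, if_true]

end Causal

/-! ### Combs controlled by their initial memory -/

section Reduced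

variable {dI dO : ℕ → ℕ} {m n r : ℕ}

/-- The Choi operator of a comb whose final memory is traced out. -/
def Comb.reduced (c : Comb dI dO m n r) (σ : Matrix (Fin m) (Fin m) ℂ) :
    Matrix (Unit × Sys dI n × Sys dO n) (Unit × Sys dI n × Sys dO n) ℂ :=
  Matrix.of fun p q => (c.block σ p.2.1 q.2.1 p.2.2 q.2.2).trace

theorem Comb.reduced_eq_submatrix (c : Comb dI dO m n 1) (σ : Matrix (Fin m) (Fin m) ℂ) :
    c.reduced σ = (c.choi σ).submatrix (fun p => (p.2.1, p.2.2, 0)) fun p => (p.2.1, p.2.2, 0) := by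
  ext p q
  simp [Comb.reduced, Comb.choi, Matrix.trace]

theorem Comb.choi_eq_submatrix (c : Comb dI dO m n 1) (σ : Matrix (Fin m) (Fin m) ℂ) :
    c.choi σ = (c.reduced σ).submatrix (fun p => ((), p.1, p.2.1)) fun p => ((), p.1, p.2.1) := by
  ext p q
  simp [Comb.reduced, Comb.choi, Matrix.trace, Subsingleton.elim _ (0 : Fin 1)]

theorem Comb.posSemidef_reduced (c : Comb dI dO m n 1) {σ : Matrix (Fin m) (Fin m) ℂ}
    (hσ : σ.PosSemidef) : (c.reduced σ).PosSemidef := by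
  rw [c.reduced_eq_submatrix]
  exact (c.posSemidef_choi hσ).submatrix _

theorem Comb.block_smul_add_smul (c : Comb dI dO m n r) (x y : ℂ) (σ τ : Matrix (Fin m) (Fin m) ℂ)
    (a a' : Sys dI n) (b b' : Sys dO n) :
    c.block (x • σ + y • τ) a a' b b' = x • c.block σ a a' b b' + y • c.block τ a a' b b' := by
  induction c with
  | nil => rfl
  | snoc c Φ ih =>
    ext k k'
    simp [Comb.block, ih, Matrix.add_kronecker, Matrix.smul_kronecker]

theorem Comb.choi_smul_add_smul (c : Comb dI dO m n r) (x y : ℂ)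
    (σ τ : Matrix (Fin m) (Fin m) ℂ) :
    c.choi (x • σ + y • τ) = x • c.choi σ + y • c.choi τ := by
  ext p q
  simp [Comb.choi, c.block_smul_add_smul]

/-- The initial memory acts as a classical control: only the diagonal of σ matters. -/
theorem exists_comb_controlled (hI : ∀ i ≤ n, 0 < dI i) (hO : ∀ i ≤ n, 0 < dO i)
    {T : Fin m → Matrix (Unit × Sys dI (n + 1) × Sys dO (n + 1))
      (Unit × Sys dI (n + 1) × Sys dO (n + 1)) ℂ}
    (hT : ∀ i, IsCausal (n + 1) (T i)) (hp : ∀ i, (T i).PosSemidef) :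
    ∃ c : Comb dI dO m (n + 1) 1, ∀ σ, c.reduced σ = ∑ i, σ i i • T i := by
  obtain ⟨c, hc⟩ := exists_comb_of_isCausal (fun i hi => hI i (by omega))
    (fun i hi => hO i (by omega)) (isCausal_controlled hT) (posSemidef_controlled hp)
  refine ⟨c, fun σ => ?_⟩
  ext p q
  simp [Comb.reduced, Matrix.trace, hc, controlled, Matrix.sum_apply]

end Reduced

/-! ### Distinguishability cost -/

section Cost

variable {dA dB : ℕ → ℕ} {n : ℕ}

/-- The smoothing in `DmaxSmooth` ranges over strategies with trivial initial memory, so the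
prepared qubit has to be absorbed. -/
theorem exists_strategy_of_ket0 (hA : ∀ i ≤ n, 0 < dA i) (hB : ∀ i ≤ n, 0 < dB i)
    (S : Comb dA dB 2 (n + 1) 1) : ∃ N : Strategy dA dB (n + 1), N.choi = S.choi ket0 := by
  obtain ⟨N, hN⟩ := exists_comb_controlled (m := 1) hA hB
    (fun _ => S.isCausal_trace_block (σ := ket0) (by simp [ket0]))
    (fun _ => S.posSemidef_reduced (posSemidef_single 0))
  refine ⟨N, ?_⟩
  rw [Strategy.choi, Comb.choi_eq_submatrix, Comb.choi_eq_submatrix, hN]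
  simp
  rfl

theorem DmaxSmooth_le_cost (hA : ∀ i ≤ n, 0 < dA i) (hB : ∀ i ≤ n, 0 < dB i) (ε : ℝ)
    (N M : Strategy dA dB (n + 1)) : DmaxSmooth ε N M ≤ cost ε N M := by
  rw [cost, le_log2_iff]
  refine le_iInf fun S => le_iInf fun K => le_iInf fun h => ?_
  obtain ⟨hK, hN, hM⟩ := h
  have hK0 : 0 < K := by linarith
  rw [← le_log2_iff, log2_ofReal hK0]
  obtain ⟨N', hN'⟩ := exists_strategy_of_ket0 hA hB S
  rw [← hN'] at hN
  refine (iInf₂_le N' hN).trans (iInf₂_le _ ?_)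
  rw [Real.rpow_logb two_pos (by norm_num) hK0, LoewnerLE]
  -- The difference of the two sides is (K - 1) S(|1⟩⟨1|).
  refine posSemidef_of_eq ((S.posSemidef_choi (posSemidef_single 1)).smul (sub_nonneg.2 hK)) ?_
  rw [Strategy.choi, Strategy.choi] at *
  rw [← hM, hN', piState, S.choi_smul_add_smul, ket0]
  ext p q
  have : (K : ℂ) ≠ 0 := by exact_mod_cast hK0.ne'
  simp only [Matrix.sub_apply, Matrix.add_apply, Matrix.smul_apply, Complex.real_smul,
    smul_eq_mul]
  push_cast
  field_simp
  ring

theorem trace_reduced (N : Strategy dA dB (n + 1)) :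
    (Comb.reduced N 1).trace = ∏ i ∈ Finset.range (n + 1), (dA i : ℂ) := by
  rw [Comb.reduced, (Comb.isCausal_trace_block N (σ := 1) (by simp)).trace_eq]
  simp

/-- Both Choi operators have the same positive trace, which forces K ≥ 1. -/
theorem exists_complement (hA : ∀ i ≤ n, 0 < dA i) {N M : Strategy dA dB (n + 1)} {K : ℝ}
    (hK0 : 0 < K) (h : LoewnerLE N.choi (K • M.choi)) :
    1 ≤ K ∧ ∃ R : Matrix (Unit × Sys dA (n + 1) × Sys dB (n + 1))
      (Unit × Sys dA (n + 1) × Sys dB (n + 1)) ℂ, IsCausal (n + 1) R ∧ R.PosSemidef ∧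
        ((1 / K : ℝ) : ℂ) • Comb.reduced N 1 + ((1 - 1 / K : ℝ) : ℂ) • R = Comb.reduced M 1 := by
  have hD : (K • Comb.reduced M 1 - Comb.reduced N 1).PosSemidef := by
    rw [Comb.reduced_eq_submatrix, Comb.reduced_eq_submatrix]
    exact h.submatrix _
  have htr : (K • Comb.reduced M 1 - Comb.reduced N 1).trace =
      (((K - 1) * ∏ i ∈ Finset.range (n + 1), (dA i : ℝ) : ℝ) : ℂ) := by
    rw [Matrix.trace_sub, Matrix.trace_smul, trace_reduced, trace_reduced, Complex.real_smul]
    push_cast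
    ring
  have hpos : 0 < ∏ i ∈ Finset.range (n + 1), (dA i : ℝ) :=
    Finset.prod_pos fun i hi => by
      exact_mod_cast hA i (Nat.lt_succ_iff.1 (Finset.mem_range.1 hi))
  have hK : 1 ≤ K := by
    have := hD.trace_nonneg
    rw [htr, Complex.zero_le_real] at this
    linarith [nonneg_of_mul_nonneg_left this hpos]
  have hcN := Comb.isCausal_trace_block N (σ := 1) (by simp)
  have hcM := Comb.isCausal_trace_block M (σ := 1) (by simp)
  refine ⟨hK, ?_⟩
  rcases hK.eq_or_lt with rfl | hK1
  -- For K = 1 the difference is positive with trace zero, so N and M coincide; `R` has weight zero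
  -- and may be any causal positive operator.
  · refine ⟨Comb.reduced M 1, hcM, M.posSemidef_reduced Matrix.PosSemidef.one, ?_⟩
    rw [sub_self, zero_mul, Complex.ofReal_zero, hD.trace_eq_zero_iff, one_smul, sub_eq_zero] at htr
    simp [htr]
  · have hk : (K : ℂ) - 1 ≠ 0 := by
      exact_mod_cast (sub_pos.2 hK1).ne'
    have hk0 : (K : ℂ) ≠ 0 := by exact_mod_cast hK0.ne'
    refine ⟨((K : ℂ) / (K - 1)) • Comb.reduced M 1 + (-1 / ((K : ℂ) - 1)) • Comb.reduced N 1,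
      hcM.affine (by field_simp; ring) hcN, ?_, ?_⟩
    · refine posSemidef_of_eq (hD.smul (inv_nonneg.2 (sub_nonneg.2 hK))) ?_
      ext p q
      simp only [Matrix.sub_apply, Matrix.add_apply, Matrix.smul_apply, Complex.real_smul,
        smul_eq_mul]
      push_cast
      field_simp
      ring
    · ext p q
      simp only [Matrix.add_apply, Matrix.smul_apply, smul_eq_mul]
      push_cast
      field_simp
      ring

theorem cost_le_DmaxSmooth (hA : ∀ i ≤ n, 0 < dA i) (hB : ∀ i ≤ n, 0 < dB i) (ε : ℝ)
    (N M : Strategy dA dB (n + 1)) : cost ε N M ≤ DmaxSmooth ε N M := by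
  refine le_iInf₂ fun N' hN' => le_iInf₂ fun l hl => ?_
  have hK0 : (0 : ℝ) < 2 ^ l := Real.rpow_pos_of_pos two_pos l
  obtain ⟨hK, R, hR, hRp, hRM⟩ := exists_complement hA hK0 hl
  -- The qubit selects N' on |0⟩ and the complement on |1⟩.
  obtain ⟨S, hS⟩ := exists_comb_controlled (m := 2) (T := ![Comb.reduced N' 1, R]) hA hB
    (by
      intro i
      fin_cases i
      · exact Comb.isCausal_trace_block N' (σ := 1) (by simp)
      · exact hR)
    (by
      intro i
      fin_cases i
      · exact N'.posSemidef_reduced Matrix.PosSemidef.one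
      · exact hRp)
  have h0 : S.choi ket0 = N'.choi := by
    rw [Strategy.choi, Comb.choi_eq_submatrix, Comb.choi_eq_submatrix, hS]
    simp [ket0]
  have hM : S.choi (piState (2 ^ l)) = M.choi := by
    rw [Strategy.choi, Comb.choi_eq_submatrix, Comb.choi_eq_submatrix, hS, ← hRM]
    simp [piState]
  have hl : (l : EReal) = log2 (ENNReal.ofReal (2 ^ l)) := by
    rw [log2_ofReal hK0, Real.logb_rpow two_pos (by norm_num)]
  rw [hl, cost]
  refine log2_mono (iInf_le_of_le S <| iInf_le_of_le _ <| iInf_le _ ⟨hK, ?_, hM⟩)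
  rwa [h0]

/-- The co-strategy purifies the one that emits maximally mixed states. Its Choi operator before
purification is a nonzero multiple of the identity, so the reference R retains everything and
contraction with it can be inverted. -/
theorem exists_informationally_complete (hA : ∀ i ≤ n, 0 < dA i) (hB : ∀ i ≤ n, 0 < dB i) :
    ∃ (r : ℕ) (S : CoStrategy dA dB (n + 1) r), ∀ Γ Γ' : StrategyOp dA dB (n + 1),
      interact Γ S = interact Γ' S → Γ = Γ' := by
  have hI : ∀ i < n + 1, 0 < coDim dB i := by
    rintro (_ | i) hi
    · exact one_pos
    · exact hB i (by omega)
  have hO : ∀ i < n + 1, 0 < dA i := fun i hi => hA i (by omega)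
  set c : ℂ := ∏ i ∈ Finset.range (n + 1), (dA i : ℂ)⁻¹ with hc
  have hc0 : c ≠ 0 := Finset.prod_ne_zero_iff.2 fun i hi =>
    inv_ne_zero (by exact_mod_cast (hO i (Finset.mem_range.1 hi)).ne')
  have hcp : 0 ≤ c := Finset.prod_nonneg fun i _ => by
    rw [← Complex.ofReal_natCast, ← Complex.ofReal_inv, Complex.zero_le_real]
    positivity
  obtain ⟨r, S, G, hG, hS⟩ := exists_comb_purification (m := 1) hI hO (isCausal_smul_one hO)
    (Matrix.PosSemidef.one.smul hcp)
  refine ⟨r, S, fun Γ Γ' h => ?_⟩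
  -- `H` is the purification with the trivial initial memory and the dummy first input of the
  -- co-strategy dropped; each output block of the final state is HᵀΓ(Hᵀ)ᴴ, with (Hᵀ)ᴴHᵀ = c · 1.
  let H : Matrix (Sys dA (n + 1) × Sys dB n) (Fin r) ℂ :=
    G.submatrix (fun p => (0, coInput p.2, p.1)) id
  have hH : H * Hᴴ = c • 1 := by
    ext p q
    have h1 := congrFun (congrFun hG (0, coInput p.2, p.1)) (0, coInput q.2, q.1)
    have h2 : coInput p.2 = coInput q.2 ↔ p.2 = q.2 := (Fin.cons_right_injective _).eq_iff
    rw [Matrix.smul_apply, Matrix.one_apply] at h1 ⊢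
    refine h1.trans ?_
    simp [Prod.ext_iff, h2, and_comm, hc]
  have hint (Γ : StrategyOp dA dB (n + 1)) (y y' : Fin (dB n)) (k k' : Fin r) :
      interact Γ S (k, y) (k', y') = (Hᵀ * (Matrix.of fun p q : Sys dA (n + 1) × Sys dB n =>
        Γ (p.1, addLast p.2 y, 0) (q.1, addLast q.2 y', 0)) * Hᵀᴴ) k k' := by
    simp only [interact, Comb.choi, hS, Matrix.of_apply, Matrix.mul_apply, Fintype.sum_prod_type,
      Matrix.sum_apply, Fintype.sum_unique, Finset.sum_mul]
    rw [Finset.sum_comm]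
    refine Finset.sum_congr rfl fun a' _ => ?_
    rw [Finset.sum_comm (s := (Finset.univ : Finset (Sys dB n)))]
    refine Finset.sum_congr rfl fun a _ => Finset.sum_comm.trans ?_
    refine Finset.sum_congr rfl fun b' _ => Finset.sum_congr rfl fun b _ => ?_
    simp [H, Matrix.vecMulVec_apply, mul_comm, mul_left_comm]
  have key (y y' : Fin (dB n)) : (Matrix.of fun p q : Sys dA (n + 1) × Sys dB n =>
        Γ (p.1, addLast p.2 y, 0) (q.1, addLast q.2 y', 0)) =
      Matrix.of fun p q => Γ' (p.1, addLast p.2 y, 0) (q.1, addLast q.2 y', 0) := by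
    have hHT : Hᵀᴴ * Hᵀ = c • 1 := by
      have := congrArg Matrix.transpose hH
      rw [Matrix.transpose_mul, Matrix.transpose_smul, Matrix.transpose_one] at this
      exact this
    have h1 : Hᵀ * (Matrix.of fun p q : Sys dA (n + 1) × Sys dB n =>
          Γ (p.1, addLast p.2 y, 0) (q.1, addLast q.2 y', 0)) * Hᵀᴴ =
        Hᵀ * (Matrix.of fun p q : Sys dA (n + 1) × Sys dB n =>
          Γ' (p.1, addLast p.2 y, 0) (q.1, addLast q.2 y', 0)) * Hᵀᴴ := by
      ext k k'
      rw [← hint, ← hint, h]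
    have h2 := congrArg (fun X => Hᵀᴴ * X * Hᵀ) h1
    simp only [← Matrix.mul_assoc, hHT] at h2
    simp only [Matrix.mul_assoc, hHT] at h2
    simpa [hc0] using h2
  ext ⟨a, b, u⟩ ⟨a', b', u'⟩
  obtain rfl : u = 0 := Subsingleton.elim _ _
  obtain rfl : u' = 0 := Subsingleton.elim _ _
  rw [← addLast_init b, ← addLast_init b']
  exact congrFun (congrFun (key _ _) (a, _)) (a', _)

theorem DmaxSmooth_zero (hA : ∀ i ≤ n, 0 < dA i) (hB : ∀ i ≤ n, 0 < dB i)
    (N M : Strategy dA dB (n + 1)) : DmaxSmooth 0 N M = Dmax N M := by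
  refine le_antisymm (iInf₂_le N ?_) (le_iInf₂ fun N' hN' => ?_)
  · refine (EReal.div_le_iff_le_mul zero_lt_two (by decide)).2 (iSup₂_le fun r S => ?_)
    rw [sub_self, traceNorm_eq_of_conjTranspose_mul_self (c := 0) (by simp)]
    simp
  · obtain ⟨r, S, hS⟩ := exists_informationally_complete hA hB
    have h1 := (EReal.div_le_iff_le_mul zero_lt_two (by decide)).1 hN'
    have h2 : ((traceNorm (interact N'.choi S - interact N.choi S) : ℝ) : EReal) ≤ (0 : ℝ) :=
      (le_iSup₂_of_le r S le_rfl).trans (h1.trans (by simp))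
    have h3 := eq_zero_of_traceNorm_eq_zero
      (le_antisymm (EReal.coe_le_coe_iff.1 h2) (traceNorm_nonneg _))
    rw [Dmax, Dmax, hS _ _ (sub_eq_zero.1 h3)]

end Cost

end QStrat

theorem theorem1 (dA dB : ℕ → ℕ) (n : ℕ)
    (hA : ∀ i ≤ n, 0 < dA i) (hB : ∀ i ≤ n, 0 < dB i)
    (ε : ℝ) (N M : Strategy dA dB (n + 1)) :
    distillable ε N M = DminSmooth ε N M ∧
    cost ε N M = DmaxSmooth ε N M ∧
    distillable 0 N M = Dmin N M ∧
    cost 0 N M = Dmax N M := by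
  have hc (ε : ℝ) : cost ε N M = DmaxSmooth ε N M :=
    (cost_le_DmaxSmooth hA hB ε N M).antisymm (DmaxSmooth_le_cost hA hB ε N M)
  exact ⟨distillable_eq_DminSmooth ε N M, hc ε,
    (distillable_eq_DminSmooth 0 N M).trans (DminSmooth_zero N M),
    (hc 0).trans (DmaxSmooth_zero hA hB N M)⟩
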